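/- Let $d\ge 3$ be an integer. For a finite simple graph $G$ with at least one edge, the modularity is $$q^*(G)=\max_{\mathcal A}\sum_{A\in\mathcal A}\left(\frac{e(A)}{|E(G)|}-\frac{\big(\sum_{v\in A}\deg(v)\big)^2}{4|E(G)|^2}\right),$$ where the maximum is over all partitions $\mathcal A$ of $V(G)$ into nonempty parts and $e(A)$ is the number of edges of $G$ with both ends in $A$. Let $\mathcal G_{n,d}$ be a uniformly random $d$-regular simple graph on $n$ labelled vertices ($dn$ even). An event holds a.a.s. if its probability tends to $1$ as $n\to\infty$ with $dn$ even. For $x\in(0,1)$ and $y\in(0,d)$ with $d-2xd+xy>0$ put $$\begin{aligned}f(x,y,d)={}&x\left(\tfrac y2-1\right)\log x+(1-x)(d-1)\log(1-x)+\tfrac12 d\log d-\tfrac12 xy\log y\\&-x(d-y)\log(d-y)-\tfrac12(d-2xd+xy)\log(d-2xd+xy).\end{aligned}$$ Then for every $x\in(0,1)$ the function $y\mapsto f(x,y,d)$ has a largest zero $\bar y(x,d)$ among the $y\in(0,d)$ with $d-2xd+xy>0$; the supremum $$U_3(d)=\sup_{x\in(0,1)}\left(\frac{\bar y(x,d)}{d}-x\right)$$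 is finite; and for every $\varepsilon>0$, a.a.s. $$q^*(\mathcal G_{n,d})\le U_3(d)+\frac{\varepsilon}{d}.$$ -/

import Mathlib

open Finset Filter Topology

/-- `edgesInside G A` is `e(A)`, the number of edges of `G` with both ends in `A`. -/
noncomputable def edgesInside {V : Type*} (G : SimpleGraph V) (A : Finset V) : ℕ :=
  {e : Sym2 V | e ∈ G.edgeSet ∧ ∀ v ∈ e, v ∈ A}.ncard

open Classical in
/-- The modularity score of a partition of the vertex set: the edge contribution minus
the degree tax. -/
noncomputable def modularityScore {V : Type*} [Fintype V] [DecidableEq V] (G : SimpleGraph V)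
    (P : Finpartition (Finset.univ : Finset V)) : ℝ :=
  ∑ A ∈ P.parts,
    ((edgesInside G A : ℝ) / (#G.edgeFinset : ℝ)
      - (∑ v ∈ A, (G.degree v : ℝ)) ^ 2 / (4 * (#G.edgeFinset : ℝ) ^ 2))

/-- The modularity `q*(G)`: the maximum of the score over the (finitely many) partitions of the
vertex set into nonempty parts. -/
noncomputable def modularity {V : Type*} [Fintype V] [DecidableEq V] (G : SimpleGraph V) : ℝ :=
  Finset.univ.sup' Finset.univ_nonempty
    (fun P : Finpartition (Finset.univ : Finset V) => modularityScore G P)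

open Classical in
/-- The set of all `d`-regular simple graphs on the vertex set `{0, …, n - 1}`. -/
def regularGraphs (n d : ℕ) : Set (SimpleGraph (Fin n)) :=
  {G | G.IsRegularOfDegree d}

/-- The probability that a uniformly random `d`-regular graph on `n` labelled vertices has the
property `Q`. -/
noncomputable def regularGraphProb (n d : ℕ) (Q : SimpleGraph (Fin n) → Prop) : ℝ :=
  ({G | G ∈ regularGraphs n d ∧ Q G}.ncard : ℝ) / ((regularGraphs n d).ncard : ℝ)

/-- The property `Q` holds asymptotically almost surely for a random `d`-regular graph: its
probability tends to `1` as `n → ∞`, with `n` restricted to values for which `n * d` is even. -/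
def RegularAAS (d : ℕ) (Q : ∀ n : ℕ, SimpleGraph (Fin n) → Prop) : Prop :=
  Tendsto (fun n : ℕ => regularGraphProb n d (Q n)) (atTop ⊓ 𝓟 {n : ℕ | Even (n * d)}) (𝓝 1)

/-- The entropy-type function `f(x, y, d)`. -/
noncomputable def entropyF (x y d : ℝ) : ℝ :=
  x * (y / 2 - 1) * Real.log x + (1 - x) * (d - 1) * Real.log (1 - x) + d * Real.log d / 2
    - x * y * Real.log y / 2 - x * (d - y) * Real.log (d - y)
    - (d - 2 * x * d + x * y) * Real.log (d - 2 * x * d + x * y) / 2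

/-- The zeros `y ∈ (0, d)` of `f(x, ·, d)`, at which all logarithms in `f` have a positive
argument (the last one does not for all `y ∈ (0, d)` when `x > 1 / 2`). -/
def entropyZeros (x d : ℝ) : Set ℝ :=
  {y | y ∈ Set.Ioo 0 d ∧ 0 < d - 2 * x * d + x * y ∧ entropyF x y d = 0}

/-- `ȳ(x, d)`, the largest zero of `f(x, ·, d)` in `(0, d)`. -/
noncomputable def yBar (x d : ℝ) : ℝ :=
  sSup (entropyZeros x d)

/-- `U₃(d)`, the supremum of `ȳ(x, d) / d - x` over `x ∈ (0, 1)`. -/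
noncomputable def boundU3 (d : ℝ) : ℝ :=
  sSup ((fun x : ℝ => yBar x d / d - x) '' Set.Ioo 0 1)

/-! ### The entropy function -/

/-! The proof is a first moment computation in the configuration model. For a set of k = xn vertices
spanning m edges let y = 2m/k be its average inner degree. The expected number of such sets is at
most a polynomial in n times exp(n f(x, y, d)) (`card_exists_inner_eq_le`). At y = xd the function f
is the entropy of x, hence positive, and at y = d it is negative; so f is negative beyond its
largest zero. By compactness f ≤ -c for η ≤ x ≤ 1 - η and d(U₃ + x) + δ ≤ y ≤ d
(`exists_entropyF_le_neg`). Thus, outside an exponentially small proportion of configurations, every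
set of such a size has y at most d(U₃ + x) + δ.

This bound is enough for the modularity. A part with xn vertices contributes x(y/d - x) to the
score, which is now at most x(U₃ + δ/d). Tiny parts are merged into groups of moderate size, and a
nearly spanning part loses almost all its edge contribution to the degree tax
(`modularity_le_of_forall_linear`).

To pass to random graphs, all d-regular graphs come from equally many configurations
(`exists_card_over`), and the simple configurations form at least an inverse polynomial proportion
of all (`factorial_le_mul_card_simple`). This crude proportion suffices against exp(-cn). Binomial
coefficients are estimated by single terms of binomial expansions, so Stirling's formula is not
needed. -/

theorem continuous_entropyF (d : ℝ) : Continuous fun p : ℝ × ℝ => entropyF p.1 p.2 d := by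
  -- Each logarithm is paired with its own argument: t log t is continuous on all of ℝ, with value 0
  -- at t = 0. So f is continuous also where an argument vanishes, in particular at y = d.
  have h : (fun p : ℝ × ℝ => entropyF p.1 p.2 d) = fun p =>
      (p.2 / 2 - 1) * (p.1 * Real.log p.1) + (d - 1) * ((1 - p.1) * Real.log (1 - p.1))
      + d * Real.log d / 2 - p.1 / 2 * (p.2 * Real.log p.2)
      - p.1 * ((d - p.2) * Real.log (d - p.2))
      - ((d - 2 * p.1 * d + p.1 * p.2) * Real.log (d - 2 * p.1 * d + p.1 * p.2)) / 2 := by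
    funext p
    unfold entropyF
    ring
  rw [h]
  have h1 : Continuous fun p : ℝ × ℝ => p.1 * Real.log p.1 := Real.Continuous.mul_log continuous_fst
  have h2 : Continuous fun p : ℝ × ℝ => (1 - p.1) * Real.log (1 - p.1) :=
    Real.Continuous.mul_log (by fun_prop)
  have h3 : Continuous fun p : ℝ × ℝ => p.2 * Real.log p.2 := Real.Continuous.mul_log continuous_snd
  have h4 : Continuous fun p : ℝ × ℝ => (d - p.2) * Real.log (d - p.2) :=
    Real.Continuous.mul_log (by fun_prop)
  have h5 : Continuous fun p : ℝ × ℝ =>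
      (d - 2 * p.1 * d + p.1 * p.2) * Real.log (d - 2 * p.1 * d + p.1 * p.2) :=
    Real.Continuous.mul_log (by fun_prop)
  fun_prop

theorem continuous_entropyF_right (x d : ℝ) : Continuous fun y => entropyF x y d :=
  (continuous_entropyF d).comp (Continuous.prodMk_right x)

theorem entropyF_right_end {x d : ℝ} (hx : x ∈ Set.Ioo (0 : ℝ) 1) (hd : 0 < d) :
    entropyF x d d = (d / 2 - 1) * (x * Real.log x + (1 - x) * Real.log (1 - x)) := by
  have h : d - 2 * x * d + x * d = d * (1 - x) := by ring
  have h1 : 0 < 1 - x := by linarith [hx.2]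
  unfold entropyF
  rw [h, Real.log_mul hd.ne' h1.ne']
  simp
  ring

/-- The value y = xd is the inner degree expected of a random set, so only the entropy of choosing
the set remains. Its positivity gives the sign change that produces a zero. -/
theorem entropyF_mean {x d : ℝ} (hx : x ∈ Set.Ioo (0 : ℝ) 1) (hd : 0 < d) :
    entropyF x (x * d) d = -(x * Real.log x + (1 - x) * Real.log (1 - x)) := by
  have h : d - 2 * x * d + x * (x * d) = d * ((1 - x) * (1 - x)) := by ring
  have h' : d - x * d = d * (1 - x) := by ring
  have h1 : 0 < 1 - x := by linarith [hx.2]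
  have h2 : 0 < x := hx.1
  unfold entropyF
  rw [h, h', Real.log_mul hd.ne' h1.ne', Real.log_mul hd.ne' (by positivity),
    Real.log_mul h1.ne' h1.ne', Real.log_mul h2.ne' hd.ne']
  ring

theorem mul_log_add_mul_log_neg {x : ℝ} (hx : x ∈ Set.Ioo (0 : ℝ) 1) :
    x * Real.log x + (1 - x) * Real.log (1 - x) < 0 := by
  have h1 := Real.log_neg hx.1 hx.2
  have h2 : Real.log (1 - x) < 0 := Real.log_neg (by linarith [hx.2]) (by linarith [hx.1])
  have h3 := mul_neg_of_pos_of_neg hx.1 h1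
  have h4 : (1 - x) * Real.log (1 - x) < 0 := mul_neg_of_pos_of_neg (by linarith [hx.2]) h2
  linarith

/-- The expression increases with y and equals d(1 - x)² at y = xd. Hence the domain condition holds
automatically in the range of y that matters. -/
theorem last_log_arg_pos {x y d : ℝ} (hx : x ∈ Set.Ioo (0 : ℝ) 1) (hd : 0 < d) (hy : x * d ≤ y) :
    0 < d - 2 * x * d + x * y := by
  have h1 : 0 < 1 - x := by linarith [hx.2]
  have h2 : x * (x * d) ≤ x * y := mul_le_mul_of_nonneg_left hy hx.1.le
  have h3 : 0 < d * (1 - x) ^ 2 := by positivity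
  nlinarith

theorem entropyF_right_end_neg {x d : ℝ} (hx : x ∈ Set.Ioo (0 : ℝ) 1) (hd : 2 < d) :
    entropyF x d d < 0 := by
  rw [entropyF_right_end hx (by linarith)]
  exact mul_neg_of_pos_of_neg (by linarith) (mul_log_add_mul_log_neg hx)

/-- Any value of `f(x, ·, d)` that is nonnegative is followed by a zero. -/
theorem exists_entropyZero_ge {x y d : ℝ} (hx : x ∈ Set.Ioo (0 : ℝ) 1) (hd : 2 < d)
    (hy : x * d ≤ y) (hyd : y ≤ d) (hf : 0 ≤ entropyF x y d) :
    ∃ z ∈ entropyZeros x d, y ≤ z := by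
  have hneg := entropyF_right_end_neg hx hd
  have hd0 : 0 < d := by linarith
  obtain ⟨z, hz, hz0⟩ := intermediate_value_Icc' hyd (continuous_entropyF_right x d).continuousOn
    (show (0 : ℝ) ∈ Set.Icc (entropyF x d d) (entropyF x y d) from ⟨hneg.le, hf⟩)
  have hzd : z ≠ d := by
    rintro rfl
    exact hneg.ne hz0
  exact ⟨z, ⟨⟨lt_of_lt_of_le (mul_pos hx.1 hd0) (hy.trans hz.1), lt_of_le_of_ne hz.2 hzd⟩,
    last_log_arg_pos hx hd0 (hy.trans hz.1), hz0⟩, hz.1⟩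

theorem isGreatest_yBar {x d : ℝ} (hx : x ∈ Set.Ioo (0 : ℝ) 1) (hd : 2 < d) :
    IsGreatest (entropyZeros x d) (yBar x d) ∧ x * d < yBar x d := by
  have hd0 : 0 < d := by linarith
  have hmean : 0 < entropyF x (x * d) d := by
    rw [entropyF_mean hx hd0]
    linarith [mul_log_add_mul_log_neg hx]
  have hxd : x * d ≤ d := by nlinarith [hx.2]
  have hneg := entropyF_right_end_neg hx hd
  -- Zeros below xd cannot be the largest, so it suffices to maximise over a compact set of zeros.
  let K : Set ℝ := Set.Icc (x * d) d ∩ {y | entropyF x y d = 0}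
  have hK : IsCompact K := isCompact_Icc.inter_right
    (isClosed_singleton.preimage (continuous_entropyF_right x d))
  obtain ⟨z, hz, hxz⟩ := exists_entropyZero_ge hx hd le_rfl hxd hmean.le
  obtain ⟨w, hwK, hw⟩ := hK.exists_isGreatest ⟨z, ⟨⟨hxz, hz.1.2.le⟩, hz.2.2⟩⟩
  have hwd : w < d := lt_of_le_of_ne hwK.1.2 (by rintro rfl; exact hneg.ne hwK.2)
  have hwx : x * d < w := lt_of_le_of_ne hwK.1.1 (by rintro h; rw [h] at hmean; exact hmean.ne' hwK.2)
  have hG : IsGreatest (entropyZeros x d) w := by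
    refine ⟨⟨⟨lt_trans (mul_pos hx.1 hd0) hwx, hwd⟩, last_log_arg_pos hx hd0 hwx.le, hwK.2⟩, ?_⟩
    intro y hy
    rcases le_total y (x * d) with h | h
    · exact h.trans hwx.le
    · exact hw ⟨⟨h, hy.1.2.le⟩, hy.2.2⟩
  have : yBar x d = w := hG.csSup_eq
  rw [this]
  exact ⟨hG, hwx⟩

theorem isLUB_boundU3 {d : ℝ} (hd : 2 < d) :
    IsLUB ((fun x : ℝ => yBar x d / d - x) '' Set.Ioo 0 1) (boundU3 d) := by
  refine isLUB_csSup ⟨_, ⟨1 / 2, by norm_num, rfl⟩⟩ ⟨1, ?_⟩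
  rintro _ ⟨x, hx, rfl⟩
  have h := (isGreatest_yBar hx hd).1.1.1.2
  have : yBar x d / d < 1 := (div_lt_one (by linarith)).2 h
  simp only
  linarith [hx.1]

/-- Positivity ensures that the line y = d(U₃ + x) lies above y = xd, where zeros of f can be
located. -/
theorem boundU3_pos {d : ℝ} (hd : 2 < d) : 0 < boundU3 d := by
  have hx : (1 / 2 : ℝ) ∈ Set.Ioo (0 : ℝ) 1 := by norm_num
  have h1 := (isLUB_boundU3 hd).1 ⟨1 / 2, hx, rfl⟩
  have h2 := (isGreatest_yBar hx hd).2
  have : 1 / 2 < yBar (1 / 2) d / d := (lt_div_iff₀ (by linarith)).2 h2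
  simp only at h1
  linarith

/-- Uniformly away from `x = 0` and `x = 1`, the function `f` is bounded away from `0` above the
line `y = d (U₃(d) + x) + δ`. -/
theorem exists_entropyF_le_neg {d δ η : ℝ} (hd : 2 < d) (hδ : 0 < δ) (hη : 0 < η) :
    ∃ c > 0, ∀ x y, η ≤ x → x ≤ 1 - η → d * (boundU3 d + x) + δ ≤ y → y ≤ d →
      entropyF x y d ≤ -c := by
  let D : Set (ℝ × ℝ) := (Set.Icc η (1 - η) ×ˢ Set.Icc 0 d) ∩
    {p | d * (boundU3 d + p.1) + δ ≤ p.2}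
  have hD : IsCompact D := (isCompact_Icc.prod isCompact_Icc).inter_right
    (isClosed_le (by fun_prop) (by fun_prop))
  have hU := boundU3_pos hd
  have hneg : ∀ p ∈ D, entropyF p.1 p.2 d < 0 := by
    rintro ⟨x, y⟩ ⟨⟨hx, hy⟩, hxy⟩
    simp only [Set.mem_ofPred_eq] at hx hy hxy ⊢
    have hx' : x ∈ Set.Ioo (0 : ℝ) 1 := ⟨by linarith [hx.1], by linarith [hx.2]⟩
    -- A nonnegative value would be followed by a zero, which lies at or below `yBar x d` and hence
    -- at or below d(U₃ + x), contradicting the margin δ.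
    by_contra! hf
    have hUd : 0 < d * boundU3 d := mul_pos (by linarith) hU
    obtain ⟨z, hz, hyz⟩ := exists_entropyZero_ge hx' hd (by nlinarith) hy.2 hf
    have h1 := (isGreatest_yBar hx' hd).1.2 hz
    have h2 := (isLUB_boundU3 hd).1 ⟨x, hx', rfl⟩
    simp only at h2
    have h3 : yBar x d / d ≤ boundU3 d + x := by linarith
    rw [div_le_iff₀ (by linarith)] at h3
    linarith
  rcases D.eq_empty_or_nonempty with h | h
  · refine ⟨1, one_pos, fun x y h1 h2 h3 h4 => ?_⟩
    have : (x, y) ∈ D := ⟨⟨⟨h1, h2⟩, by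
      have : 0 < d * (boundU3 d + x) := mul_pos (by linarith) (by linarith)
      exact ⟨by simp only; linarith, h4⟩⟩, h3⟩
    simp [h] at this
  · obtain ⟨p, hp, hmax⟩ := hD.exists_isMaxOn h (continuous_entropyF d).continuousOn
    refine ⟨-entropyF p.1 p.2 d, by linarith [hneg p hp], fun x y h1 h2 h3 h4 => ?_⟩
    have : (x, y) ∈ D := ⟨⟨⟨h1, h2⟩, by
      have : 0 < d * (boundU3 d + x) := mul_pos (by linarith) (by linarith)
      exact ⟨by simp only; linarith, h4⟩⟩, h3⟩
    have := hmax this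
    simp only [Set.mem_ofPred_eq] at this
    linarith

/-! ### Reduction to vertex sets of linear size -/

open Classical in
-- Ordered pairs are easier to bound by degrees and to match with the edge ends of a configuration.
-- The identity is the handshake lemma for the graph of edges inside A.
theorem two_mul_edgesInside {V : Type*} [Fintype V] (G : SimpleGraph V) (A : Finset V) :
    2 * edgesInside G A = #{p : V × V | G.Adj p.1 p.2 ∧ p.1 ∈ A ∧ p.2 ∈ A} := by
  let H : SimpleGraph V :=
    { Adj := fun u v => G.Adj u v ∧ u ∈ A ∧ v ∈ A
      symm := ⟨fun _ _ h => ⟨h.1.symm, h.2.2, h.2.1⟩⟩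
      loopless := ⟨fun _ h => h.1.ne rfl⟩ }
  have h := H.two_mul_card_edgeFinset
  have he : edgesInside G A = #H.edgeFinset := by
    unfold edgesInside
    rw [← Set.ncard_coe_finset]
    congr 1
    ext e
    induction e with
    | _ u v => simp [H]
  rw [he, h]

open Classical in
theorem card_adj_of_mem_regularGraphs {n d : ℕ} {G : SimpleGraph (Fin n)}
    (hG : G ∈ regularGraphs n d) (v : Fin n) : #{w | G.Adj v w} = d := by
  rw [← hG v, ← SimpleGraph.card_neighborFinset_eq_degree]
  congr 1
  ext w
  simp

theorem two_mul_edgesInside_le {n d : ℕ} {G : SimpleGraph (Fin n)} (hG : G ∈ regularGraphs n d)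
    (A : Finset (Fin n)) : 2 * edgesInside G A ≤ d * #A := by
  classical
  rw [two_mul_edgesInside]
  calc _ ≤ #(A.sigma fun v => {w | G.Adj v w}) := by
        refine Finset.card_le_card_of_injOn (fun p => ⟨p.1, p.2⟩) ?_ ?_
        · intro p hp
          simp only [coe_filter, mem_univ, true_and, Set.mem_ofPred_eq] at hp
          simp [hp]
        · rintro ⟨a, b⟩ _ ⟨a', b'⟩ _ h
          simpa using h
    _ = d * #A := by
        rw [card_sigma, sum_congr rfl (fun v _ => card_adj_of_mem_regularGraphs hG v)]
        simp [mul_comm]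

theorem sum_edgesInside_le {n : ℕ} (G : SimpleGraph (Fin n)) {s : Finset (Finset (Fin n))}
    (hs : (s : Set (Finset (Fin n))).PairwiseDisjoint id) :
    ∑ A ∈ s, edgesInside G A ≤ edgesInside G (s.biUnion id) := by
  classical
  have h : ∑ A ∈ s, 2 * edgesInside G A ≤ 2 * edgesInside G (s.biUnion id) := by
    simp only [two_mul_edgesInside]
    rw [← card_biUnion]
    · refine card_le_card fun p hp => ?_
      simp only [mem_biUnion, mem_filter, mem_univ, true_and, id] at hp ⊢
      obtain ⟨A, hA, h1, h2, h3⟩ := hp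
      exact ⟨h1, ⟨A, hA, h2⟩, ⟨A, hA, h3⟩⟩
    · intro A hA B hB hAB
      refine Finset.disjoint_left.2 fun p hp hp' => ?_
      simp only [mem_filter, mem_univ, true_and] at hp hp'
      exact Finset.disjoint_left.1 (hs hA hB hAB) hp.2.1 hp'.2.1
  rw [← mul_sum] at h
  omega

theorem two_mul_card_edgeFinset_of_regular {n d : ℕ} {G : SimpleGraph (Fin n)}
    (hG : G ∈ regularGraphs n d) [Fintype G.edgeSet] : 2 * #G.edgeFinset = n * d := by
  classical
  have h := G.sum_degrees_eq_twice_card_edges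
  have h2 : ∑ v, G.degree v = n * d := by
    rw [sum_congr rfl (fun v _ => (by convert hG v : G.degree v = d))]
    simp
  rw [← h2, h]
  congr!

/-- If every union of members of a disjoint family of small sets which has size in `[η, 2η)`
satisfies a linear bound, then so does the whole family, up to an error `η`. -/
theorem sum_le_of_grouping {V : Type*} [DecidableEq V] {g x : Finset V → ℝ} {η c : ℝ}
    (hη : 0 < η) (hc : 0 ≤ c) (hx0 : ∀ A, 0 ≤ x A)
    (hx : ∀ s : Finset (Finset V), (s : Set (Finset V)).PairwiseDisjoint id →
      x (s.biUnion id) = ∑ A ∈ s, x A)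
    (hg : ∀ s : Finset (Finset V), (s : Set (Finset V)).PairwiseDisjoint id →
      ∑ A ∈ s, g A ≤ g (s.biUnion id))
    (hgx : ∀ A, g A ≤ x A) (hmid : ∀ A, η ≤ x A → x A < 2 * η → g A ≤ c * x A)
    (s : Finset (Finset V)) (hs : (s : Set (Finset V)).PairwiseDisjoint id)
    (hsmall : ∀ A ∈ s, x A < η) :
    ∑ A ∈ s, g A ≤ c * ∑ A ∈ s, x A + η := by
  induction s using Finset.strongInduction with
  | H s ih =>
    -- A remainder of total size below η is paid for by the additive error, since g ≤ x on its
    -- union.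
    by_cases hlt : ∑ A ∈ s, x A < η
    · have h1 := hg s hs
      have h2 := hgx (s.biUnion id)
      rw [hx s hs] at h2
      have h3 : 0 ≤ ∑ A ∈ s, x A := sum_nonneg fun A _ => hx0 A
      nlinarith [mul_nonneg hc h3]
    · push Not at hlt
      -- A subfamily of least cardinality with total at least η has total below 2η, since removing
      -- one small member takes it below η. Its union is covered by `hmid`, and the rest by
      -- induction.
      have hne : (s.powerset.filter fun t => η ≤ ∑ A ∈ t, x A).Nonempty :=
        ⟨s, by simp [hlt]⟩
      obtain ⟨t, ht, hmin⟩ := Finset.exists_min_image _ card hne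
      simp only [mem_filter, mem_powerset] at ht hmin
      obtain ⟨hts, hηt⟩ := ht
      have htne : t.Nonempty := by
        rw [Finset.nonempty_iff_ne_empty]
        rintro rfl
        simp only [sum_empty] at hηt
        linarith
      obtain ⟨A, hA⟩ := htne
      have hup : ∑ B ∈ t, x B < 2 * η := by
        have h1 : ∑ B ∈ t.erase A, x B < η := by
          by_contra! hcon
          have := hmin (t.erase A) ⟨(erase_subset _ _).trans hts, hcon⟩
          have := card_erase_lt_of_mem hA
          omega
        rw [← add_sum_erase _ _ hA]
        linarith [hsmall A (hts hA)]
      have htd : (t : Set (Finset V)).PairwiseDisjoint id := hs.subset (by exact_mod_cast hts)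
      have h1 := hmid (t.biUnion id) (by rw [hx t htd]; exact hηt) (by rw [hx t htd]; exact hup)
      rw [hx t htd] at h1
      have h2 := hg t htd
      have hss : s \ t ⊂ s := by
        refine ⟨sdiff_subset, fun h => ?_⟩
        have := h (hts hA)
        simp [hA] at this
      have h3 := ih (s \ t) hss (hs.subset (by simp))
        (fun B hB => hsmall B (sdiff_subset hB))
      rw [← sum_sdiff hts, ← sum_sdiff (f := fun A => x A) hts]
      linarith

/-- With x = |A|/n and g = 2e(A)/(nd), the score is the sum of g - x². Parts of moderate size use
the hypothesis, and there the tax cancels the term x². If x ≥ 1 - η, then g - x² ≤ x(1 - x) ≤ ηx.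
Parts with x < η are grouped and their tax is dropped. -/
theorem modularity_le_of_forall_linear {n d : ℕ} (hn : 0 < n) (hd : 0 < d)
    {G : SimpleGraph (Fin n)} (hG : G ∈ regularGraphs n d) {η δ U : ℝ} (hη : 0 < η)
    (hη3 : η ≤ 1 / 3) (hU : 0 ≤ U) (hδ : 0 ≤ δ)
    (h : ∀ A : Finset (Fin n), η * n ≤ #A → #A ≤ (1 - η) * n →
      2 * (edgesInside G A : ℝ) ≤ (d * (U + #A / n) + δ) * #A) :
    modularity G ≤ U + δ / d + 3 * η := by
  classical
  have hn' : (0 : ℝ) < n := by exact_mod_cast hn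
  have hd' : (0 : ℝ) < d := by exact_mod_cast hd
  let x : Finset (Fin n) → ℝ := fun A => #A / n
  let g : Finset (Fin n) → ℝ := fun A => 2 * edgesInside G A / (n * d)
  have hx0 : ∀ A, 0 ≤ x A := fun A => by positivity
  have hx : ∀ s : Finset (Finset (Fin n)), (s : Set (Finset (Fin n))).PairwiseDisjoint id →
      x (s.biUnion id) = ∑ A ∈ s, x A := by
    intro s hs
    simp only [x]
    rw [card_biUnion hs, ← sum_div]
    push_cast
    rfl
  have hg : ∀ s : Finset (Finset (Fin n)), (s : Set (Finset (Fin n))).PairwiseDisjoint id →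
      ∑ A ∈ s, g A ≤ g (s.biUnion id) := by
    intro s hs
    simp only [g]
    rw [← sum_div, ← mul_sum]
    have : ∑ A ∈ s, (edgesInside G A : ℝ) ≤ edgesInside G (s.biUnion id) := by
      exact_mod_cast sum_edgesInside_le G hs
    gcongr
  have hgx : ∀ A, g A ≤ x A := by
    intro A
    simp only [g, x]
    rw [div_le_div_iff₀ (by positivity) hn']
    have : 2 * (edgesInside G A : ℝ) ≤ d * #A := by exact_mod_cast two_mul_edgesInside_le hG A
    nlinarith
  have hlin : ∀ A, η ≤ x A → x A ≤ 1 - η → g A ≤ x A * (U + x A + δ / d) := by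
    intro A h1 h2
    simp only [x] at h1 h2
    rw [le_div_iff₀ hn'] at h1
    rw [div_le_iff₀ hn'] at h2
    have h3 := h A h1 h2
    simp only [g, x]
    rw [div_le_iff₀ (by positivity)]
    calc 2 * (edgesInside G A : ℝ) ≤ (d * (U + #A / n) + δ) * #A := h3
      _ = _ := by field_simp
  -- The term 2η bounds the size of a group of small parts; η ≤ 1/3 gives 2η ≤ 1 - η, so that the
  -- hypothesis applies to the group. The third η of the conclusion is the grouping error.
  set c := U + δ / d + 2 * η with hc
  have hδd : 0 ≤ δ / d := by positivity
  have hc0 : 0 ≤ c := by positivity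
  unfold modularity
  refine Finset.sup'_le _ _ fun P _ => ?_
  have hscore : modularityScore G P = ∑ A ∈ P.parts, (g A - x A ^ 2) := by
    unfold modularityScore
    refine sum_congr rfl fun A _ => ?_
    have hE : (#G.edgeFinset : ℝ) = n * d / 2 := by
      have : 2 * (#G.edgeFinset : ℝ) = n * d := by
        exact_mod_cast two_mul_card_edgeFinset_of_regular hG
      linarith
    have hdeg : ∑ v ∈ A, (G.degree v : ℝ) = d * #A := by
      rw [sum_congr rfl (fun v _ => by rw [hG v]; : ∀ v ∈ A, (G.degree v : ℝ) = d)]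
      simp [mul_comm]
    rw [hE, hdeg]
    simp only [g, x]
    field_simp
    ring
  have hdisj : (P.parts : Set (Finset (Fin n))).PairwiseDisjoint id := P.disjoint
  have hsum1 : ∑ A ∈ P.parts, x A = 1 := by
    rw [← hx _ hdisj, ← Finset.sup_eq_biUnion, P.sup_parts]
    simp only [x, card_univ, Fintype.card_fin]
    exact div_self hn'.ne'
  rw [hscore, ← sum_filter_add_sum_filter_not P.parts (fun A => x A < η)]
  have hsmall : ∑ A ∈ P.parts with x A < η, (g A - x A ^ 2)
      ≤ c * (∑ A ∈ P.parts with x A < η, x A) + η := by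
    refine (sum_le_sum fun A _ => sub_le_self (g A) (sq_nonneg (x A))).trans ?_
    refine sum_le_of_grouping hη hc0 hx0 hx hg hgx ?_ _ (hdisj.subset ?_) (by simp)
    swap
    · exact_mod_cast filter_subset _ _
    intro A h1 h2
    have h3 := hlin A h1 (by linarith)
    have := hx0 A
    nlinarith
  have hbig : ∑ A ∈ P.parts with ¬ x A < η, (g A - x A ^ 2)
      ≤ c * (∑ A ∈ P.parts with ¬ x A < η, x A) := by
    rw [mul_sum]
    refine sum_le_sum fun A hA => ?_
    simp only [mem_filter, not_lt] at hA
    have h0 := hx0 A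
    rcases le_total (x A) (1 - η) with h1 | h1
    · have := hlin A hA.2 h1
      nlinarith
    · have := hgx A
      nlinarith
  rw [← sum_filter_add_sum_filter_not P.parts (fun A => x A < η)] at hsum1
  calc _ ≤ c * (∑ A ∈ P.parts with x A < η, x A + ∑ A ∈ P.parts with ¬ x A < η, x A) + η := by
        linarith
    _ = U + δ / d + 3 * η := by rw [hsum1, hc]; ring

/-! ### The configuration model -/

/-- A configuration assigns the two ends of `M` labelled edges bijectively to `n * d` points,
`d` at each of `n` vertices. -/
abbrev Configuration (M n d : ℕ) := Fin M × Bool ≃ Fin n × Fin d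

/-- The other end of the same edge. -/
def otherEnd {M : ℕ} (x : Fin M × Bool) : Fin M × Bool := (x.1, !x.2)

@[simp] theorem otherEnd_otherEnd {M : ℕ} (x : Fin M × Bool) : otherEnd (otherEnd x) = x := by
  simp [otherEnd]

@[simp] theorem otherEnd_ne {M : ℕ} (x : Fin M × Bool) : otherEnd x ≠ x := by
  simp [otherEnd, Prod.ext_iff]

theorem otherEnd_inj {M : ℕ} {x y : Fin M × Bool} : otherEnd x = otherEnd y ↔ x = y :=
  ⟨fun h => by rw [← otherEnd_otherEnd x, h, otherEnd_otherEnd], fun h => h ▸ rfl⟩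

namespace Configuration

variable {M n d : ℕ}

/-- The vertex at an edge end, together with the vertex at the other end of the edge. -/
def ends (σ : Configuration M n d) (x : Fin M × Bool) : Fin n × Fin n :=
  ((σ x).1, (σ (otherEnd x)).1)

/-- `G` is the graph obtained from the configuration. -/
def Over (σ : Configuration M n d) (G : SimpleGraph (Fin n)) : Prop :=
  ∀ v w, G.Adj v w ↔ ∃ x, ends σ x = (v, w)

/-- The fixed-point-free involution of the points which a configuration induces. -/
def partner (σ : Configuration M n d) : Equiv.Perm (Fin n × Fin d) :=
  ((σ.symm.trans ⟨otherEnd, otherEnd, otherEnd_otherEnd, otherEnd_otherEnd⟩).trans σ)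

theorem partner_apply (σ : Configuration M n d) (p : Fin n × Fin d) :
    partner σ p = σ (otherEnd (σ.symm p)) := rfl

theorem partner_mul_self (σ : Configuration M n d) : partner σ * partner σ = 1 := by
  ext1 p
  simp [partner_apply]

theorem partner_ne (σ : Configuration M n d) (p : Fin n × Fin d) : partner σ p ≠ p := by
  intro h
  rw [partner_apply, ← Equiv.eq_symm_apply] at h
  exact otherEnd_ne _ h

/-- The graph depends on σ only through the induced involution, so configurations can be counted one
involution at a time. -/
theorem over_iff (σ : Configuration M n d) (G : SimpleGraph (Fin n)) :
    Over σ G ↔ ∀ v w, G.Adj v w ↔ ∃ i, (partner σ (v, i)).1 = w := by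
  refine forall_congr' fun v => forall_congr' fun w => iff_congr Iff.rfl ?_
  constructor
  · rintro ⟨x, hx⟩
    simp only [ends, Prod.mk.injEq] at hx
    refine ⟨(σ x).2, ?_⟩
    rw [← hx.1, partner_apply]
    simpa using hx.2
  · rintro ⟨i, hi⟩
    exact ⟨σ.symm (v, i), by simpa [ends, partner_apply] using hi⟩

theorem cycleType_involution {α : Type*} [Fintype α] [DecidableEq α] {ι : Equiv.Perm α}
    (h2 : ι * ι = 1) (hne : ∀ p, ι p ≠ p) (p : α) :
    ι.cycleType = Multiset.replicate (Fintype.card α / 2) 2 := by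
  have ho : orderOf ι = 2 := by
    refine orderOf_eq_prime (by rw [pow_two, h2]) ?_
    rintro rfl
    exact hne p rfl
  obtain ⟨k, hk⟩ := Equiv.Perm.cycleType_prime_order (σ := ι) (by rw [ho]; exact Nat.prime_two)
  rw [ho] at hk
  have hs := ι.sum_cycleType
  have hsupp : ι.support = univ := by
    ext q
    simp [hne q]
  rw [hsupp, hk] at hs
  simp only [Multiset.sum_replicate, card_univ, smul_eq_mul] at hs
  rw [hk]
  congr 1
  omega

open Classical in
-- Fixed-point-free involutions share a cycle type and so are conjugate; composing σ with the
-- conjugating permutation carries one fibre to the other.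
theorem card_partner_eq {ι ι' : Equiv.Perm (Fin n × Fin d)} (h : ι * ι = 1) (h' : ι' * ι' = 1)
    (hne : ∀ p, ι p ≠ p) (hne' : ∀ p, ι' p ≠ p) :
    #{σ : Configuration M n d | partner σ = ι} = #{σ : Configuration M n d | partner σ = ι'} := by
  rcases isEmpty_or_nonempty (Fin n × Fin d) with he | ⟨⟨p⟩⟩
  · rw [Subsingleton.elim ι ι']
  have hconj : IsConj ι ι' := by
    rw [Equiv.Perm.isConj_iff_cycleType_eq, cycleType_involution h hne p,
      cycleType_involution h' hne' p]
  obtain ⟨τ, hτ⟩ := isConj_iff.1 hconj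
  refine Finset.card_bij' (fun σ _ => σ.trans τ) (fun σ _ => σ.trans τ.symm) ?_ ?_ ?_ ?_
  · intro σ hσ
    simp only [mem_filter, mem_univ, true_and] at hσ ⊢
    rw [← hτ, ← hσ]
    ext1 q
    simp [partner_apply]
  · intro σ hσ
    simp only [mem_filter, mem_univ, true_and] at hσ ⊢
    have : ι = τ⁻¹ * ι' * τ := by rw [← hτ]; group
    rw [this, ← hσ]
    ext1 q
    simp [partner_apply]
  · intro σ _
    ext1 q
    simp
  · intro σ _
    ext1 q
    simp

/-- The d values exhaust the d neighbours of v, so none is repeated. -/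
theorem injective_of_adj_iff_exists {G : SimpleGraph (Fin n)} (hG : G ∈ regularGraphs n d)
    {F : Fin n → Fin d → Fin n} (hF : ∀ v w, G.Adj v w ↔ ∃ i, F v i = w) (v : Fin n) :
    Function.Injective (F v) := by
  classical
  have h1 : univ.image (F v) = ({w | G.Adj v w} : Finset (Fin n)) := by
    ext w
    simp [hF]
  have h2 := card_adj_of_mem_regularGraphs hG v
  have h3 : #(univ.image (F v)) = #(univ : Finset (Fin d)) := by
    rw [h1, card_univ, Fintype.card_fin]
    convert h2
  rw [Finset.card_image_iff] at h3
  simpa using h3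

open Classical in
/-- The involutions of the points which induce a given regular graph correspond to the labellings
of the neighbours of every vertex. -/
noncomputable def involutionEquivLabelling {G : SimpleGraph (Fin n)}
    (hG : G ∈ regularGraphs n d) :
    {ι : Equiv.Perm (Fin n × Fin d) // ι * ι = 1 ∧ ∀ v w, G.Adj v w ↔ ∃ i, (ι (v, i)).1 = w} ≃
      (∀ v, Fin d ≃ {w // G.Adj v w}) where
  toFun ι v := Equiv.ofBijective
    (fun i => ⟨(ι.1 (v, i)).1, (ι.2.2 v _).2 ⟨i, rfl⟩⟩)
    ⟨fun i j hij => injective_of_adj_iff_exists hG (F := fun v i => (ι.1 (v, i)).1) ι.2.2 v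
        (congrArg Subtype.val hij),
      fun w => by
        obtain ⟨i, hi⟩ := (ι.2.2 v w.1).1 w.2
        exact ⟨i, Subtype.ext hi⟩⟩
  invFun l :=
    -- The point (v, i) is matched with the point at the i-th neighbour w of v whose label at w is
    -- v.
    have hinv : Function.Involutive fun p : Fin n × Fin d =>
        ((l p.1 p.2).1, (l (l p.1 p.2).1).symm ⟨p.1, (l p.1 p.2).2.symm⟩) := by
      rintro ⟨v, i⟩
      have key : ∀ (w : {w // G.Adj (l v i).1 w}), w.1 = v → ∀ h,
          ((w.1, (l w.1).symm ⟨(l v i).1, h⟩) : Fin n × Fin d) = (v, i) := by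
        intro w hw h
        obtain rfl : w = ⟨v, (l v i).2.symm⟩ := Subtype.ext hw
        simp
      exact key _ (by simp) _
    ⟨hinv.toPerm, by
      constructor
      · ext1 p
        exact hinv p
      · intro v w
        constructor
        · intro h
          exact ⟨(l v).symm ⟨w, h⟩, by simp⟩
        · rintro ⟨i, rfl⟩
          exact (l v i).2⟩
  left_inv := by
    rintro ⟨ι, h1, h2⟩
    apply Subtype.ext
    ext1 ⟨v, i⟩
    have hinv : ι (ι (v, i)) = (v, i) := by
      rw [← Equiv.Perm.mul_apply, h1]; rfl
    refine Prod.ext rfl ?_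
    exact (Equiv.symm_apply_eq _).2 (Subtype.ext (congrArg Prod.fst hinv).symm)
  right_inv := by
    intro l
    funext v
    ext i
    rfl

/-- All regular graphs arise from the same number of configurations. -/
theorem exists_card_over (hM : 2 * M = n * d) :
    ∃ κ : ℕ, ∀ G ∈ regularGraphs n d, {σ : Configuration M n d | Over σ G}.ncard = κ := by
  classical
  have hcard : Fintype.card (Fin M × Bool) = Fintype.card (Fin n × Fin d) := by
    simp [← hM, mul_comm]
  let σ₀ : Configuration M n d := Fintype.equivOfCardEq hcard
  -- There are d! labellings of the neighbours of each vertex, hence (d!)ⁿ involutions over G, each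
  -- induced by equally many configurations.
  refine ⟨d.factorial ^ n * #{σ : Configuration M n d | partner σ = partner σ₀}, fun G hG => ?_⟩
  let I : Finset (Equiv.Perm (Fin n × Fin d)) :=
    {ι | ι * ι = 1 ∧ ∀ v w, G.Adj v w ↔ ∃ i, (ι (v, i)).1 = w}
  have hI : #I = d.factorial ^ n := by
    have h1 : #I = Fintype.card (∀ v, Fin d ≃ {w // G.Adj v w}) := by
      rw [← Fintype.card_congr (involutionEquivLabelling hG), Fintype.card_subtype]
    rw [h1, Fintype.card_pi]
    have : ∀ v : Fin n, Fintype.card (Fin d ≃ {w // G.Adj v w}) = d.factorial := by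
      intro v
      have hc : Fintype.card {w // G.Adj v w} = Fintype.card (Fin d) := by
        rw [Fintype.card_subtype, Fintype.card_fin]
        convert card_adj_of_mem_regularGraphs hG v
      rw [Fintype.card_equiv (Fintype.equivOfCardEq hc.symm), Fintype.card_fin]
    simp [this]
  have hS : {σ : Configuration M n d | Over σ G}.ncard
      = #{σ : Configuration M n d | Over σ G} := by
    rw [← Set.ncard_coe_finset]
    congr 1
    ext
    simp
  rw [hS, card_eq_sum_card_fiberwise (f := partner) (t := I), ← hI, ← smul_eq_mul, ← sum_const]
  · refine sum_congr rfl fun ι hι => ?_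
    simp only [I, mem_filter, mem_univ, true_and] at hι
    have hne : ∀ p, ι p ≠ p := by
      rintro ⟨v, i⟩ h
      exact (((hι.2 v v).2 ⟨i, by rw [h]⟩)).ne rfl
    rw [← card_partner_eq hι.1 (partner_mul_self σ₀) hne (partner_ne σ₀), filter_filter]
    congr 1
    ext σ
    simp only [mem_filter, mem_univ, true_and, and_iff_right_iff_imp]
    rintro rfl
    exact (over_iff σ G).2 hι.2
  · intro σ hσ
    simp only [coe_filter, mem_univ, true_and, Set.mem_ofPred_eq, I] at hσ ⊢
    exact ⟨partner_mul_self σ, (over_iff σ G).1 hσ⟩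

theorem card_filter_fst_eq (σ : Configuration M n d) (v : Fin n) : #{x | (σ x).1 = v} = d := by
  have : #{x | (σ x).1 = v} = #(univ.image fun i : Fin d => (v, i)) := by
    rw [← card_map σ.toEmbedding]
    congr 1
    ext ⟨w, i⟩
    simp only [Finset.mem_map, mem_filter, mem_univ, true_and, Equiv.coe_toEmbedding, mem_image,
      Prod.mk.injEq]
    constructor
    · rintro ⟨x, hx, h⟩
      exact ⟨i, by rw [← hx, h], rfl⟩
    · rintro ⟨j, rfl, rfl⟩
      exact ⟨σ.symm (v, j), by simp⟩
  rw [this, card_image_of_injective _ (fun i j h => by simpa using h)]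
  simp

theorem Over.injective_ends {σ : Configuration M n d} {G : SimpleGraph (Fin n)} (h : Over σ G)
    (hG : G ∈ regularGraphs n d) : Function.Injective (ends σ) := by
  intro x y hxy
  have h1 := injective_of_adj_iff_exists hG (F := fun v i => (partner σ (v, i)).1) ((over_iff σ G).1 h) (σ x).1
  simp only [ends, Prod.mk.injEq] at hxy
  have h2 : (σ x).2 = (σ y).2 := by
    apply h1
    simp only
    conv_rhs => rw [hxy.1]
    simp [partner_apply, hxy.2]
  exact σ.injective (Prod.ext hxy.1 h2)

/-- Injectivity of `ends` encodes simplicity: a loop repeats a pair at its own two ends, and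
parallel edges repeat a pair at ends of different edges. -/
theorem exists_over_of_injective {σ : Configuration M n d} (h : Function.Injective (ends σ)) :
    ∃ G ∈ regularGraphs n d, Over σ G := by
  classical
  let G : SimpleGraph (Fin n) :=
    { Adj := fun v w => ∃ x, ends σ x = (v, w)
      symm := ⟨by
        rintro v w ⟨x, hx⟩
        simp only [ends, Prod.mk.injEq] at hx
        exact ⟨otherEnd x, by simp [ends, hx]⟩⟩
      loopless := ⟨by
        rintro v ⟨x, hx⟩
        simp only [ends, Prod.mk.injEq] at hx
        refine otherEnd_ne x (h ?_)
        simp [ends, hx]⟩ }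
  refine ⟨G, ?_, fun v w => Iff.rfl⟩
  intro v
  rw [← SimpleGraph.card_neighborFinset_eq_degree, ← card_filter_fst_eq σ v]
  symm
  refine Finset.card_bij (fun x _ => (σ (otherEnd x)).1) ?_ ?_ ?_
  · intro x hx
    simp only [mem_filter, mem_univ, true_and] at hx
    rw [SimpleGraph.mem_neighborFinset]
    exact ⟨x, by simp [ends, hx]⟩
  · intro x hx y hy hxy
    simp only [mem_filter, mem_univ, true_and] at hx hy
    exact h (by simp [ends, hx, hy, hxy])
  · intro w hw
    rw [SimpleGraph.mem_neighborFinset] at hw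
    obtain ⟨x, hx⟩ := hw
    simp only [ends, Prod.mk.injEq] at hx
    exact ⟨x, by simp [hx.1], hx.2⟩

theorem Over.unique {σ : Configuration M n d} {G G' : SimpleGraph (Fin n)} (h : Over σ G)
    (h' : Over σ G') : G = G' := by
  ext v w
  rw [h v w, h' v w]

/-- The number of edges with both ends in `A`. -/
def inner (σ : Configuration M n d) (A : Finset (Fin n)) : ℕ :=
  #{e | (σ (e, false)).1 ∈ A ∧ (σ (e, true)).1 ∈ A}

theorem Over.edgesInside_eq {σ : Configuration M n d} {G : SimpleGraph (Fin n)} (h : Over σ G)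
    (hG : G ∈ regularGraphs n d) (A : Finset (Fin n)) : edgesInside G A = inner σ A := by
  classical
  have h1 := two_mul_edgesInside G A
  have h2 : #{p : Fin n × Fin n | G.Adj p.1 p.2 ∧ p.1 ∈ A ∧ p.2 ∈ A}
      = #{x : Fin M × Bool | (σ x).1 ∈ A ∧ (σ (otherEnd x)).1 ∈ A} := by
    rw [← card_map ⟨ends σ, h.injective_ends hG⟩]
    congr 1
    ext ⟨v, w⟩
    simp only [mem_filter, mem_univ, true_and, Finset.mem_map, Function.Embedding.coeFn_mk, h v w]
    constructor
    · rintro ⟨⟨x, hx⟩, hv, hw⟩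
      refine ⟨x, ?_, hx⟩
      simp only [ends, Prod.mk.injEq] at hx
      rw [hx.1, hx.2]
      exact ⟨hv, hw⟩
    · rintro ⟨x, hA, hx⟩
      refine ⟨⟨x, hx⟩, ?_⟩
      simp only [ends, Prod.mk.injEq] at hx
      rwa [hx.1, hx.2] at hA
  have h3 : #{x : Fin M × Bool | (σ x).1 ∈ A ∧ (σ (otherEnd x)).1 ∈ A} = 2 * inner σ A := by
    have : ({x : Fin M × Bool | (σ x).1 ∈ A ∧ (σ (otherEnd x)).1 ∈ A} : Finset (Fin M × Bool))
        = ({e | (σ (e, false)).1 ∈ A ∧ (σ (e, true)).1 ∈ A} : Finset (Fin M)) ×ˢ univ := by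
      ext ⟨e, b⟩
      simp only [mem_filter, mem_univ, true_and, mem_product, and_true]
      cases b <;> simp [otherEnd, and_comm]
    rw [this, card_product, inner]
    simp [mul_comm]
  have h4 : 2 * edgesInside G A = 2 * inner σ A := by
    rw [h1, ← h3, ← h2]
    congr!
  omega

end Configuration

/-! ### Simple configurations are not rare -/

/-- The symmetric group is j-transitive, so every injective choice of images for j given points is
attained by equally many bijections. -/
theorem card_equiv_comp_eq_mul {α β : Type*} [Fintype α] [Fintype β] [DecidableEq α]
    [DecidableEq β] (e : α ≃ β) {j : ℕ} (p : Fin j ↪ α) (r : Fin j ↪ β) :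
    #{σ : α ≃ β | ⇑σ ∘ p = r} * (Fintype.card β).descFactorial j = (Fintype.card β).factorial := by
  have hsame : ∀ r' : Fin j ↪ β, #{σ : α ≃ β | ⇑σ ∘ p = r'} = #{σ : α ≃ β | ⇑σ ∘ p = r} := by
    intro r'
    have := Equiv.Perm.isMultiplyPretransitive β j
    obtain ⟨τ, hτ⟩ := MulAction.exists_smul_eq (Equiv.Perm β) r' r
    have hτ' : ∀ i, τ (r' i) = r i := fun i => by rw [← hτ]; rfl
    refine Finset.card_bij' (fun σ _ => σ.trans τ) (fun σ _ => σ.trans τ.symm) ?_ ?_ ?_ ?_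
    · intro σ hσ
      simp only [mem_filter, mem_univ, true_and, funext_iff, Function.comp_apply] at hσ ⊢
      simp [hσ, hτ']
    · intro σ hσ
      simp only [mem_filter, mem_univ, true_and, funext_iff, Function.comp_apply] at hσ ⊢
      simp [hσ, ← hτ']
    · intro σ _
      ext1 q
      simp
    · intro σ _
      ext1 q
      simp
  have h := card_eq_sum_card_fiberwise (s := (univ : Finset (α ≃ β)))
    (t := (univ : Finset (Fin j ↪ β))) (f := fun σ => p.trans σ.toEmbedding) (by simp)
  have h2 : ∀ r' : Fin j ↪ β, #{σ ∈ (univ : Finset (α ≃ β)) | p.trans σ.toEmbedding = r'}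
      = #{σ : α ≃ β | ⇑σ ∘ p = r} := by
    intro r'
    rw [← hsame r']
    congr 1
    ext σ
    simp only [mem_filter, mem_univ, true_and, ← DFunLike.coe_fn_eq]
    rfl
  rw [sum_congr rfl (fun r' _ => h2 r')] at h
  rw [card_univ, Fintype.card_equiv e, sum_const, card_univ, Fintype.card_embedding_eq] at h
  simp only [Fintype.card_fin, smul_eq_mul] at h
  rw [mul_comm, ← h, Fintype.card_congr e]

theorem card_equiv_comp_mem_mul_le {α β : Type*} [Fintype α] [Fintype β] [DecidableEq α]
    [DecidableEq β] (e : α ≃ β) {j : ℕ} (p : Fin j ↪ α) (R : Finset (Fin j → β)) :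
    #{σ : α ≃ β | ⇑σ ∘ p ∈ R} * (Fintype.card β).descFactorial j
      ≤ #R * (Fintype.card β).factorial := by
  rw [card_eq_sum_card_fiberwise (f := fun σ : α ≃ β => ⇑σ ∘ p) (t := R), sum_mul, ← smul_eq_mul,
    ← sum_const]
  · refine sum_le_sum fun (r : Fin j → β) _ => ?_
    by_cases hr : Function.Injective r
    · rw [← card_equiv_comp_eq_mul e p ⟨r, hr⟩]
      exact Nat.mul_le_mul_right _ (card_le_card (filter_subset_filter _ (subset_univ _)))
    · have h0 : ∀ S : Finset (α ≃ β), #(S.filter fun σ : α ≃ β => ⇑σ ∘ p = r) = 0 := by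
        intro S
        rw [card_eq_zero, filter_eq_empty_iff]
        intro σ _ h
        subst h
        exact hr (σ.injective.comp p.injective)
      rw [h0]
      simp
  · intro σ hσ
    simpa using hσ

namespace Configuration

variable {M n d : ℕ}

/-- The edge ends at which a loop or a multiple edge occurs. -/
def bad (σ : Configuration M n d) : Finset (Fin M × Bool) :=
  {x | ∃ y, y ≠ x ∧ ends σ y = ends σ x}

theorem injective_ends_iff (σ : Configuration M n d) :
    Function.Injective (ends σ) ↔ #(bad σ) ≤ 0 := by
  simp only [nonpos_iff_eq_zero, card_eq_zero, bad, filter_eq_empty_iff, mem_univ, true_implies,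
    not_exists, not_and]
  constructor
  · intro h x y hyx he
    exact hyx (h he)
  · intro h x y hxy
    by_contra hne
    exact h (x := y) x hne hxy

theorem card_filter_fst_mem (σ : Configuration M n d) (T : Finset (Fin n)) :
    #{x | (σ x).1 ∈ T} = #T * d := by
  rw [card_eq_sum_card_fiberwise (f := fun x => (σ x).1) (t := T), ← smul_eq_mul, ← sum_const]
  · refine sum_congr rfl fun v hv => ?_
    refine Eq.trans ?_ (card_filter_fst_eq σ v)
    rw [filter_filter]
    congr 1
    ext x
    simp only [mem_filter, mem_univ, true_and, and_iff_right_iff_imp]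
    rintro rfl
    exact hv
  · intro x hx
    simpa using hx

theorem card_filter_fst_otherEnd_mem (σ : Configuration M n d) (T : Finset (Fin n)) :
    #{x | (σ (otherEnd x)).1 ∈ T} = #T * d := by
  rw [← card_filter_fst_mem σ T]
  refine Finset.card_bij' (fun x _ => otherEnd x) (fun x _ => otherEnd x) ?_ ?_ ?_ ?_ <;> simp

/-- A loop or multiple edge can be removed by exchanging ends with a suitable other edge. -/
theorem exists_swap_bad_ssubset (σ : Configuration M n d) (hne : (bad σ).Nonempty)
    (hlarge : #(bad σ) + (2 * d + 3) * d < 2 * M) :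
    ∃ y z, bad ((Equiv.swap y z).trans σ) ⊂ bad σ := by
  obtain ⟨x, hx⟩ := hne
  set a : Fin M × Bool → Fin n := fun z => (σ z).1 with ha
  let nb : Fin n → Finset (Fin n) := fun u => ({z | a z = u} : Finset _).image fun z => a (otherEnd z)
  have hnb : ∀ u, #(nb u) ≤ d := fun u => card_image_le.trans (card_filter_fst_eq σ u).le
  -- The second ends of the edges of x and y will be exchanged. Keeping the vertex of y out of `T₁`
  -- and that of its other end out of `T₂` prevents the new edges from being loops, parallel to old
  -- edges, or parallel to each other; for the last, y must also not be a loop.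
  let T₁ := insert (a x) (insert (a (otherEnd x)) (nb (a (otherEnd x))))
  let T₂ := insert (a x) (nb (a x))
  have hT₁ : #T₁ ≤ d + 2 :=
    (card_insert_le _ _).trans (Nat.succ_le_succ ((card_insert_le _ _).trans
      (Nat.succ_le_succ (hnb _))))
  have hT₂ : #T₂ ≤ d + 1 := (card_insert_le _ _).trans (Nat.succ_le_succ (hnb _))
  let E := bad σ ∪ (({z | a z ∈ T₁} : Finset (Fin M × Bool)) ∪
    ({z | a (otherEnd z) ∈ T₂} : Finset (Fin M × Bool)))
  have hE : #E < #(univ : Finset (Fin M × Bool)) := by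
    have h1 : #E ≤ #(bad σ) + (#T₁ * d + #T₂ * d) := by
      refine (card_union_le _ _).trans (Nat.add_le_add_left ((card_union_le _ _).trans ?_) _)
      exact Nat.add_le_add (card_filter_fst_mem σ T₁).le (card_filter_fst_otherEnd_mem σ T₂).le
    have h2 : #T₁ * d + #T₂ * d ≤ (2 * d + 3) * d := by
      rw [← add_mul]
      exact Nat.mul_le_mul_right d (by omega)
    have h3 : #(univ : Finset (Fin M × Bool)) = 2 * M := by simp [mul_comm]
    omega
  obtain ⟨y, -, hy⟩ := exists_mem_notMem_of_card_lt_card hE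
  simp only [E, T₁, T₂, nb, mem_union, mem_filter, mem_univ, true_and, mem_insert, mem_image, not_or,
    not_exists, not_and] at hy
  obtain ⟨hyb, ⟨hc1, hc2, hc3⟩, hb1, hb2⟩ := hy
  have hnl : a y ≠ a (otherEnd y) := by
    intro h
    refine hyb ?_
    simp only [bad, mem_filter, mem_univ, true_and]
    exact ⟨otherEnd y, otherEnd_ne y, by simp only [ha] at h; simp [ends, h]⟩
  have hxy : x ≠ y := by rintro rfl; exact hc1 rfl
  have hoxy : otherEnd x ≠ y := by rintro rfl; exact hc2 rfl
  have hxoy : x ≠ otherEnd y := by rintro h; exact hb1 (by rw [h])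
  have hoxoy : otherEnd x ≠ otherEnd y := fun h => hxy (otherEnd_inj.1 h)
  refine ⟨otherEnd x, otherEnd y, ?_⟩
  set σ' : Configuration M n d := (Equiv.swap (otherEnd x) (otherEnd y)).trans σ with hσ'
  have hval : ∀ z, z ≠ otherEnd x → z ≠ otherEnd y → (σ' z).1 = a z := by
    intro z h1 h2
    simp [hσ', Equiv.swap_apply_of_ne_of_ne h1 h2, ha]
  have hvx := hval x (otherEnd_ne x).symm hxoy
  have hvy := hval y hoxy.symm (otherEnd_ne y).symm
  have hvox : (σ' (otherEnd x)).1 = a (otherEnd y) := by simp [hσ', ha]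
  have hvoy : (σ' (otherEnd y)).1 = a (otherEnd x) := by simp [hσ', ha]
  have ex : ends σ' x = (a x, a (otherEnd y)) := by simp [ends, hvx, hvox]
  have eox : ends σ' (otherEnd x) = (a (otherEnd y), a x) := by simp [ends, hvx, hvox]
  have ey : ends σ' y = (a y, a (otherEnd x)) := by simp [ends, hvy, hvoy]
  have eoy : ends σ' (otherEnd y) = (a (otherEnd x), a y) := by simp [ends, hvy, hvoy]
  have ez : ∀ z, z ≠ x → z ≠ otherEnd x → z ≠ y → z ≠ otherEnd y →
      ends σ' z = (a z, a (otherEnd z)) := by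
    intro z h1 h2 h3 h4
    have h5 : otherEnd z ≠ otherEnd x := fun h => h1 (otherEnd_inj.1 h)
    have h6 : otherEnd z ≠ otherEnd y := fun h => h3 (otherEnd_inj.1 h)
    simp [ends, hval z h2 h4, hval (otherEnd z) h5 h6]
  have hb2' : ∀ z, a (otherEnd z) = a x → a z ≠ a (otherEnd y) := by
    intro z h h'
    exact hb2 (otherEnd z) h (by simpa using h')
  have hc3' : ∀ z, a (otherEnd z) = a (otherEnd x) → a z ≠ a y := by
    intro z h h'
    exact hc3 (otherEnd z) h (by simpa using h')
  -- None of the four affected ends is bad afterwards. Any remaining bad end thus has an untouched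
  -- witness and was bad before, while x is repaired.
  have hgood : ∀ t ∈ ({x, otherEnd x, y, otherEnd y} : Finset (Fin M × Bool)), ∀ z, z ≠ t →
      ends σ' z ≠ ends σ' t := by
    intro t ht z hzt
    simp only [mem_insert, mem_singleton] at ht
    by_cases h1 : z = x
    · subst h1
      rcases ht with rfl | rfl | rfl | rfl
      · exact absurd rfl hzt
      · rw [ex, eox]; grind
      · rw [ex, ey]; grind
      · rw [ex, eoy]; grind
    by_cases h2 : z = otherEnd x
    · subst h2
      rcases ht with rfl | rfl | rfl | rfl
      · rw [ex, eox]; grind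
      · exact absurd rfl hzt
      · rw [eox, ey]; grind
      · rw [eox, eoy]; grind
    by_cases h3 : z = y
    · subst h3
      rcases ht with rfl | rfl | rfl | rfl
      · rw [ex, ey]; grind
      · rw [eox, ey]; grind
      · exact absurd rfl hzt
      · rw [ey, eoy]; grind
    by_cases h4 : z = otherEnd y
    · subst h4
      rcases ht with rfl | rfl | rfl | rfl
      · rw [ex, eoy]; grind
      · rw [eox, eoy]; grind
      · rw [ey, eoy]; grind
      · exact absurd rfl hzt
    rw [ez z h1 h2 h3 h4]
    rcases ht with rfl | rfl | rfl | rfl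
    · rw [ex]; grind
    · rw [eox]; grind
    · rw [ey]; grind
    · rw [eoy]; grind
  rw [Finset.ssubset_iff_of_subset]
  · refine ⟨x, hx, ?_⟩
    simp only [bad, mem_filter, mem_univ, true_and, not_exists, not_and]
    intro z hz
    exact hgood x (by simp) z hz
  · intro z hz
    simp only [bad, mem_filter, mem_univ, true_and] at hz ⊢
    obtain ⟨w, hwz, hw⟩ := hz
    refine ⟨w, hwz, ?_⟩
    have hz' : z ∉ ({x, otherEnd x, y, otherEnd y} : Finset (Fin M × Bool)) :=
      fun h => hgood z h w hwz hw
    have hw' : w ∉ ({x, otherEnd x, y, otherEnd y} : Finset (Fin M × Bool)) :=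
      fun h => hgood w h z hwz.symm hw.symm
    simp only [mem_insert, mem_singleton, not_or] at hz' hw'
    rw [ez z hz'.1 hz'.2.1 hz'.2.2.1 hz'.2.2.2, ez w hw'.1 hw'.2.1 hw'.2.2.1 hw'.2.2.2] at hw
    simpa [ends, ha] using hw

/-- Each configuration on the left is one swap away from one on the right, and there are (2M)²
choices for the swapped pair. -/
theorem card_bad_le_le_mul (j : ℕ) (hlarge : j + 1 + (2 * d + 3) * d < 2 * M) :
    #{σ : Configuration M n d | #(bad σ) ≤ j + 1}
      ≤ (2 * M) ^ 2 * #{σ : Configuration M n d | #(bad σ) ≤ j} := by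
  let F : Configuration M n d × ((Fin M × Bool) × (Fin M × Bool)) → Configuration M n d :=
    fun p => (Equiv.swap p.2.1 p.2.2).trans p.1
  have hsub : ({σ : Configuration M n d | #(bad σ) ≤ j + 1} : Finset _) ⊆
      (({σ : Configuration M n d | #(bad σ) ≤ j} : Finset _) ×ˢ univ).image F := by
    intro σ hσ
    simp only [mem_filter, mem_univ, true_and] at hσ
    simp only [mem_image, mem_product, mem_filter, mem_univ, true_and, and_true, F]
    have key : ∃ y z, #(bad ((Equiv.swap y z).trans σ)) ≤ j := by
      rcases (bad σ).eq_empty_or_nonempty with h | h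
      · have hpos : 0 < M := by omega
        refine ⟨(⟨0, hpos⟩, true), (⟨0, hpos⟩, true), ?_⟩
        rw [Equiv.swap_self]
        change #(bad σ) ≤ j
        simp [h]
      · obtain ⟨y, z, hyz⟩ := exists_swap_bad_ssubset σ h (by omega)
        have := card_lt_card hyz
        exact ⟨y, z, by omega⟩
    obtain ⟨y, z, hyz⟩ := key
    refine ⟨((Equiv.swap y z).trans σ, (y, z)), hyz, ?_⟩
    ext1 q
    simp
  refine (card_le_card hsub).trans (card_image_le.trans ?_)
  rw [card_product, mul_comm]
  apply Nat.mul_le_mul_right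
  simp [pow_two, mul_comm 2 M]

theorem card_bad_le_le_pow_mul (K : ℕ) (hlarge : K + (2 * d + 3) * d < 2 * M) :
    #{σ : Configuration M n d | #(bad σ) ≤ K}
      ≤ (2 * M) ^ (2 * K) * #{σ : Configuration M n d | #(bad σ) ≤ 0} := by
  induction K with
  | zero => simp
  | succ j ih =>
    refine (card_bad_le_le_mul j hlarge).trans ?_
    calc (2 * M) ^ 2 * #{σ : Configuration M n d | #(bad σ) ≤ j}
        ≤ (2 * M) ^ 2 * ((2 * M) ^ (2 * j) * #{σ : Configuration M n d | #(bad σ) ≤ 0}) :=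
          Nat.mul_le_mul_left _ (ih (by omega))
      _ = _ := by ring

theorem card_configuration (hM : 2 * M = n * d) :
    Fintype.card (Configuration M n d) = (2 * M).factorial := by
  have hcard : Fintype.card (Fin M × Bool) = Fintype.card (Fin n × Fin d) := by
    simp [← hM, mul_comm]
  rw [Fintype.card_equiv (Fintype.equivOfCardEq hcard)]
  simp [mul_comm]

/-- The two ends must receive points of the same vertex, which allows at most 2M · d of the 2M(2M -
1) ordered pairs. The factor 2 absorbs 2M/(2M - 1). -/
theorem card_loop_le (hM : 2 * M = n * d) (hM3 : 3 ≤ M) (x : Fin M × Bool) :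
    2 * M * #{σ : Configuration M n d | ends σ (otherEnd x) = ends σ x}
      ≤ 2 * d * (2 * M).factorial := by
  have hcard : Fintype.card (Fin M × Bool) = Fintype.card (Fin n × Fin d) := by
    simp [← hM, mul_comm]
  let p : Fin 2 ↪ Fin M × Bool := ⟨![x, otherEnd x], by
    intro i j
    have h := otherEnd_ne x
    fin_cases i <;> fin_cases j <;> simp [h, h.symm]⟩
  let R : Finset (Fin 2 → Fin n × Fin d) := {r | (r 0).1 = (r 1).1}
  have hR : #R ≤ 2 * M * d := by
    have : #R ≤ #(univ : Finset ((Fin n × Fin d) × Fin d)) := by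
      refine card_le_card_of_injOn (fun r => (r 0, (r 1).2)) (by simp) ?_
      intro r hr s hs hrs
      simp only [R, coe_filter, mem_univ, true_and, Set.mem_ofPred_eq] at hr hs
      simp only [Prod.mk.injEq] at hrs
      funext i
      fin_cases i
      · exact hrs.1
      · exact Prod.ext (by simp only [Fin.mk_one, Fin.isValue, ← hr, ← hs, hrs.1]) hrs.2
    refine this.trans ?_
    simp [hM]
  have h := card_equiv_comp_mem_mul_le (Fintype.equivOfCardEq hcard) p R
  have hset : ({σ : Configuration M n d | ends σ (otherEnd x) = ends σ x} : Finset _)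
      ⊆ ({σ : Configuration M n d | ⇑σ ∘ p ∈ R} : Finset _) := by
    intro σ hσ
    simp only [mem_filter, mem_univ, true_and, ends, Prod.mk.injEq, R, p,
      Function.comp_apply] at hσ ⊢
    exact hσ.1.symm
  have hc : Fintype.card (Fin n × Fin d) = 2 * M := by simp [hM]
  rw [hc] at h
  obtain ⟨k, rfl⟩ : ∃ k, M = k + 3 := ⟨M - 3, by omega⟩
  have hdf : (2 * (k + 3)).descFactorial 2 = 2 * (k + 3) * (2 * k + 5) := by
    simp [Nat.descFactorial]
    have : 2 * (k + 3) - 1 = 2 * k + 5 := by omega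
    rw [this]; ring
  rw [hdf] at h
  set Q := #{σ : Configuration (k + 3) n d | ⇑σ ∘ p ∈ R}
  set P := #{σ : Configuration (k + 3) n d | ends σ (otherEnd x) = ends σ x}
  have hPQ : P ≤ Q := card_le_card hset
  set f := (2 * (k + 3)).factorial
  have h1 : 2 * (k + 3) * (Q * (2 * k + 5)) ≤ 2 * (k + 3) * (d * f) := by
    calc 2 * (k + 3) * (Q * (2 * k + 5)) = Q * (2 * (k + 3) * (2 * k + 5)) := by ring
      _ ≤ #R * f := h
      _ ≤ (2 * (k + 3) * d) * f := Nat.mul_le_mul_right _ hR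
      _ = _ := by ring
  have h2 := Nat.le_of_mul_le_mul_left h1 (by omega)
  calc 2 * (k + 3) * P ≤ 2 * (2 * k + 5) * Q := Nat.mul_le_mul (by omega) hPQ
    _ = 2 * (Q * (2 * k + 5)) := by ring
    _ ≤ 2 * (d * f) := Nat.mul_le_mul_left _ h2
    _ = 2 * d * f := by ring

/-- Four distinct ends are constrained in two pairs, leaving at most (2Md)² patterns. The factor 8
absorbs the falling factorial, as (2M)³ ≤ 8(2M - 1)(2M - 2)(2M - 3). -/
theorem card_parallel_le (hM : 2 * M = n * d) (hM3 : 3 ≤ M) {x y : Fin M × Bool} (hyx : y ≠ x)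
    (hyo : y ≠ otherEnd x) :
    (2 * M) ^ 2 * #{σ : Configuration M n d | ends σ y = ends σ x}
      ≤ 8 * d ^ 2 * (2 * M).factorial := by
  have hcard : Fintype.card (Fin M × Bool) = Fintype.card (Fin n × Fin d) := by
    simp [← hM, mul_comm]
  let p : Fin 4 ↪ Fin M × Bool := ⟨![x, y, otherEnd x, otherEnd y], by
    have h := otherEnd_ne x
    have h' := otherEnd_ne y
    have h2 : otherEnd y ≠ otherEnd x := fun h => hyx (otherEnd_inj.1 h)
    have h3 : otherEnd y ≠ x := fun h => hyo (by rw [← h, otherEnd_otherEnd])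
    intro i j
    fin_cases i <;> fin_cases j <;>
      simp [h, h.symm, h', h'.symm, h2, h2.symm, h3, h3.symm, hyx, hyx.symm, hyo, hyo.symm]⟩
  let R : Finset (Fin 4 → Fin n × Fin d) := {r | (r 0).1 = (r 1).1 ∧ (r 2).1 = (r 3).1}
  have hR : #R ≤ (2 * M * d) ^ 2 := by
    have : #R ≤ #(univ : Finset (((Fin n × Fin d) × Fin d) × ((Fin n × Fin d) × Fin d))) := by
      refine card_le_card_of_injOn (fun r => ((r 0, (r 1).2), (r 2, (r 3).2))) (by simp) ?_
      intro r hr s hs hrs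
      simp only [R, coe_filter, mem_univ, true_and, Set.mem_ofPred_eq] at hr hs
      simp only [Prod.mk.injEq] at hrs
      have e1 : r 1 = s 1 := Prod.ext (by rw [← hr.1, ← hs.1, hrs.1.1]) hrs.1.2
      have e3 : r 3 = s 3 := Prod.ext (by rw [← hr.2, ← hs.2, hrs.2.1]) hrs.2.2
      funext i
      fin_cases i
      · exact hrs.1.1
      · exact e1
      · exact hrs.2.1
      · exact e3
    refine this.trans ?_
    simp [hM, pow_two]
  have h := card_equiv_comp_mem_mul_le (Fintype.equivOfCardEq hcard) p R
  have hset : ({σ : Configuration M n d | ends σ y = ends σ x} : Finset _)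
      ⊆ ({σ : Configuration M n d | ⇑σ ∘ p ∈ R} : Finset _) := by
    intro σ hσ
    simp only [mem_filter, mem_univ, true_and, ends, Prod.mk.injEq, R, p,
      Function.comp_apply] at hσ ⊢
    exact ⟨hσ.1.symm, hσ.2.symm⟩
  have hc : Fintype.card (Fin n × Fin d) = 2 * M := by simp [hM]
  rw [hc] at h
  obtain ⟨k, rfl⟩ : ∃ k, M = k + 3 := ⟨M - 3, by omega⟩
  have hdf : (2 * (k + 3)).descFactorial 4
      = 2 * (k + 3) * ((2 * k + 5) * (2 * k + 4) * (2 * k + 3)) := by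
    simp [Nat.descFactorial]
    have h1 : 2 * (k + 3) - 1 = 2 * k + 5 := by omega
    have h2 : 2 * (k + 3) - 2 = 2 * k + 4 := by omega
    have h3 : 2 * (k + 3) - 3 = 2 * k + 3 := by omega
    rw [h1, h2, h3]; ring
  rw [hdf] at h
  set Q := #{σ : Configuration (k + 3) n d | ⇑σ ∘ p ∈ R}
  set P := #{σ : Configuration (k + 3) n d | ends σ y = ends σ x}
  have hPQ : P ≤ Q := card_le_card hset
  set f := (2 * (k + 3)).factorial
  set D := (2 * k + 5) * (2 * k + 4) * (2 * k + 3)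
  have hD : (2 * (k + 3)) ^ 3 ≤ 8 * D := by
    have e1 : 2 * (k + 3) ≤ 2 * (2 * k + 5) := by omega
    have e2 : 2 * (k + 3) ≤ 2 * (2 * k + 4) := by omega
    have e3 : 2 * (k + 3) ≤ 2 * (2 * k + 3) := by omega
    calc (2 * (k + 3)) ^ 3 = (2 * (k + 3)) * (2 * (k + 3)) * (2 * (k + 3)) := by ring
      _ ≤ (2 * (2 * k + 5)) * (2 * (2 * k + 4)) * (2 * (2 * k + 3)) :=
        Nat.mul_le_mul (Nat.mul_le_mul e1 e2) e3
      _ = 8 * D := by simp only [D]; ring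
  have h1 : 2 * (k + 3) * (Q * D) ≤ 2 * (k + 3) * (2 * (k + 3) * d ^ 2 * f) := by
    calc 2 * (k + 3) * (Q * D) = Q * (2 * (k + 3) * D) := by ring
      _ ≤ #R * f := h
      _ ≤ (2 * (k + 3) * d) ^ 2 * f := Nat.mul_le_mul_right _ hR
      _ = _ := by ring
  have h2 := Nat.le_of_mul_le_mul_left h1 (by omega)
  refine Nat.le_of_mul_le_mul_left (c := 2 * (k + 3)) ?_ (by omega)
  calc 2 * (k + 3) * ((2 * (k + 3)) ^ 2 * P) = (2 * (k + 3)) ^ 3 * P := by ring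
    _ ≤ 8 * D * Q := Nat.mul_le_mul hD hPQ
    _ = 8 * (Q * D) := by ring
    _ ≤ 8 * (2 * (k + 3) * d ^ 2 * f) := Nat.mul_le_mul_left _ h2
    _ = _ := by ring

theorem sum_card_bad_le (hM : 2 * M = n * d) (hM3 : 3 ≤ M) :
    ∑ σ : Configuration M n d, #(bad σ) ≤ (2 * d + 8 * d ^ 2) * (2 * M).factorial := by
  set f := (2 * M).factorial
  have h1 : ∀ σ : Configuration M n d, #(bad σ) ≤
      ∑ x : Fin M × Bool, ∑ y ∈ univ.erase x, if ends σ y = ends σ x then 1 else 0 := by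
    intro σ
    rw [bad, card_filter]
    refine sum_le_sum fun x _ => ?_
    split_ifs with h
    · obtain ⟨y, hyx, hy⟩ := h
      calc 1 = if ends σ y = ends σ x then 1 else 0 := by rw [if_pos hy]
        _ ≤ _ := single_le_sum (f := fun y => if ends σ y = ends σ x then 1 else 0)
          (fun _ _ => Nat.zero_le _) (mem_erase.2 ⟨hyx, mem_univ y⟩)
    · exact Nat.zero_le _
  have h2 : ∑ σ : Configuration M n d, #(bad σ) ≤
      ∑ x : Fin M × Bool, ∑ y ∈ univ.erase x, #{σ : Configuration M n d | ends σ y = ends σ x} := by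
    refine (sum_le_sum fun σ _ => h1 σ).trans (le_of_eq ?_)
    rw [sum_comm]
    refine sum_congr rfl fun x _ => ?_
    rw [sum_comm]
    refine sum_congr rfl fun y _ => ?_
    rw [card_filter]
  have h3 : ∀ x : Fin M × Bool, (2 * M) ^ 2 * ∑ y ∈ univ.erase x,
      #{σ : Configuration M n d | ends σ y = ends σ x} ≤ 2 * M * ((2 * d + 8 * d ^ 2) * f) := by
    intro x
    have ho : otherEnd x ∈ univ.erase x := by simp
    rw [← add_sum_erase _ _ ho, mul_add, mul_sum]
    have h4 : ∑ y ∈ (univ.erase x).erase (otherEnd x),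
        (2 * M) ^ 2 * #{σ : Configuration M n d | ends σ y = ends σ x}
        ≤ 2 * M * (8 * d ^ 2 * f) := by
      refine (sum_le_card_nsmul _ _ (8 * d ^ 2 * f) fun y hy => ?_).trans ?_
      · simp only [mem_erase, mem_univ, and_true] at hy
        exact card_parallel_le hM hM3 hy.2 hy.1
      · rw [smul_eq_mul]
        refine Nat.mul_le_mul_right _ ((card_le_univ _).trans ?_)
        simp [mul_comm]
    have h5 := Nat.mul_le_mul_left (2 * M) (card_loop_le (n := n) (d := d) hM hM3 x)
    calc _ ≤ 2 * M * (2 * d * f) + 2 * M * (8 * d ^ 2 * f) := by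
          refine Nat.add_le_add ?_ h4
          refine le_trans (le_of_eq ?_) h5
          ring
      _ = _ := by ring
  refine h2.trans ?_
  refine Nat.le_of_mul_le_mul_left (c := (2 * M) ^ 2) ?_ (by positivity)
  rw [mul_sum]
  refine (sum_le_card_nsmul _ _ _ fun x _ => h3 x).trans (le_of_eq ?_)
  rw [smul_eq_mul, card_univ, Fintype.card_prod, Fintype.card_fin, Fintype.card_bool]
  ring

/-- At least a polynomially small proportion of all configurations is simple. -/
theorem factorial_le_mul_card_simple (hM : 2 * M = n * d) (hM3 : 3 ≤ M)
    (hlarge : 2 * (2 * d + 8 * d ^ 2) + (2 * d + 3) * d < 2 * M) :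
    (2 * M).factorial ≤ 2 * (2 * M) ^ (4 * (2 * d + 8 * d ^ 2)) *
      #{σ : Configuration M n d | #(bad σ) ≤ 0} := by
  set C := 2 * d + 8 * d ^ 2
  have h1 := sum_card_bad_le hM hM3
  -- Markov's inequality: the mean number of bad ends is at most C, so at least half of all
  -- configurations have at most 2C. Removing these by 2C swaps costs (2M)² each, whence the
  -- exponent 4C.
  have h2 : #{σ : Configuration M n d | ¬ #(bad σ) ≤ 2 * C} * (2 * C + 1) ≤
      ∑ σ : Configuration M n d, #(bad σ) := by
    rw [← smul_eq_mul]
    refine (card_nsmul_le_sum _ (fun σ => #(bad σ)) _ fun σ hσ => ?_).trans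
      (sum_le_sum_of_subset (subset_univ _))
    simp only [mem_filter, mem_univ, true_and] at hσ
    omega
  have h3 : #{σ : Configuration M n d | #(bad σ) ≤ 2 * C} +
      #{σ : Configuration M n d | ¬ #(bad σ) ≤ 2 * C} = (2 * M).factorial := by
    rw [card_filter_add_card_filter_not, card_univ, card_configuration hM]
  have h4 : 2 * #{σ : Configuration M n d | ¬ #(bad σ) ≤ 2 * C} ≤ (2 * M).factorial := by
    refine Nat.le_of_mul_le_mul_right (c := 2 * C + 1) ?_ (by omega)
    calc _ = 2 * (#{σ : Configuration M n d | ¬ #(bad σ) ≤ 2 * C} * (2 * C + 1)) := by ring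
      _ ≤ 2 * (C * (2 * M).factorial) := Nat.mul_le_mul_left _ (h2.trans h1)
      _ ≤ (2 * M).factorial * (2 * C + 1) := by nlinarith
  have h5 := card_bad_le_le_pow_mul (M := M) (n := n) (d := d) (2 * C) hlarge
  have h6 : 2 * (2 * C) = 4 * C := by ring
  rw [h6] at h5
  calc (2 * M).factorial ≤ 2 * #{σ : Configuration M n d | #(bad σ) ≤ 2 * C} := by omega
    _ ≤ 2 * ((2 * M) ^ (4 * C) * #{σ : Configuration M n d | #(bad σ) ≤ 0}) :=
      Nat.mul_le_mul_left _ h5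
    _ = _ := by ring

end Configuration

/-! ### Counting configurations with a dense vertex set -/

theorem choose_mul_pow_le (k l : ℕ) :
    (k + l).choose k * (k ^ k * l ^ l) ≤ (k + l) ^ (k + l) := by
  rw [add_pow k l (k + l)]
  refine le_trans (le_of_eq ?_) (single_le_sum
    (f := fun i => k ^ i * l ^ (k + l - i) * (k + l).choose i) (fun _ _ => Nat.zero_le _)
    (mem_range.2 (by omega : k < k + l + 1)))
  simp only [Nat.add_sub_cancel_left]
  ring

/-- In other words, jⁱ/i! is largest at i = j. -/
theorem pow_mul_factorial_le (i j : ℕ) : j ^ i * j.factorial ≤ j ^ j * i.factorial := by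
  rcases le_total i j with h | h
  · have h1 := Nat.factorial_mul_descFactorial (Nat.sub_le j i)
    rw [Nat.sub_sub_self h] at h1
    rw [← h1]
    calc j ^ i * (i.factorial * j.descFactorial (j - i))
        ≤ j ^ i * (i.factorial * j ^ (j - i)) := by
          gcongr
          exact Nat.descFactorial_le_pow _ _
      _ = j ^ (i + (j - i)) * i.factorial := by rw [pow_add]; ring
      _ = j ^ j * i.factorial := by rw [Nat.add_sub_cancel' h]
  · calc j ^ i * j.factorial = j ^ (j + (i - j)) * j.factorial := by rw [Nat.add_sub_cancel' h]
      _ = j ^ j * (j.factorial * j ^ (i - j)) := by rw [pow_add]; ring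
      _ ≤ _ := Nat.mul_le_mul_left _ (Nat.factorial_mul_pow_sub_le_factorial h)

/-- The mode of a binomial distribution with integral mean is its mean. -/
theorem pow_le_succ_mul_choose_mul_pow (j l : ℕ) :
    (j + l) ^ (j + l) ≤ (j + l + 1) * ((j + l).choose j * (j ^ j * l ^ l)) := by
  have hterm : ∀ i ∈ range (j + l + 1), j ^ i * l ^ (j + l - i) * (j + l).choose i
      ≤ (j + l).choose j * (j ^ j * l ^ l) := by
    intro i hi
    obtain ⟨i', hi'⟩ : ∃ i', i + i' = j + l := ⟨j + l - i, by rw [mem_range] at hi; omega⟩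
    have e1 : j + l - i = i' := by omega
    rw [e1]
    have h1 : (j + l).choose i * i.factorial * i'.factorial = (j + l).factorial := by
      rw [← hi', Nat.choose_symm_add, Nat.add_choose_mul_factorial_mul_factorial]
    have h2 : (j + l).choose j * j.factorial * l.factorial = (j + l).factorial := by
      rw [Nat.choose_symm_add, Nat.add_choose_mul_factorial_mul_factorial]
    have h3 := Nat.mul_le_mul (pow_mul_factorial_le i j) (pow_mul_factorial_le i' l)
    refine Nat.le_of_mul_le_mul_right
      (c := i.factorial * i'.factorial * (j.factorial * l.factorial)) ?_ (by positivity)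
    calc j ^ i * l ^ i' * (j + l).choose i *
          (i.factorial * i'.factorial * (j.factorial * l.factorial))
        = ((j + l).choose i * i.factorial * i'.factorial) *
          (j ^ i * j.factorial * (l ^ i' * l.factorial)) := by ring
      _ ≤ ((j + l).choose j * j.factorial * l.factorial) *
          (j ^ j * i.factorial * (l ^ l * i'.factorial)) := by
          rw [h1, h2]
          exact Nat.mul_le_mul_left _ h3
      _ = _ := by ring
  calc (j + l) ^ (j + l) = ∑ i ∈ range (j + l + 1), j ^ i * l ^ (j + l - i) * (j + l).choose i :=
        add_pow j l (j + l)
    _ ≤ _ := sum_le_card_nsmul _ _ _ hterm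
    _ = _ := by rw [card_range, smul_eq_mul]

namespace Configuration

variable {M n d : ℕ}

/-- The edge ends which lie in `A`. -/
def endsIn (σ : Configuration M n d) (A : Finset (Fin n)) : Finset (Fin M × Bool) :=
  {x | (σ x).1 ∈ A}

theorem mem_endsIn (σ : Configuration M n d) (A : Finset (Fin n)) (x : Fin M × Bool) :
    x ∈ endsIn σ A ↔ (σ x).1 ∈ A := by
  simp [endsIn]

theorem card_endsIn (σ : Configuration M n d) (A : Finset (Fin n)) : #(endsIn σ A) = #A * d :=
  card_filter_fst_mem σ A

open scoped Pointwise in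
-- Permutations of the edge ends act transitively on sets of |A|d ends, so every such set is equally
-- likely to be the set of ends in A.
theorem card_endsIn_eq_mul_choose_le (hM : 2 * M = n * d) (A : Finset (Fin n))
    (S : Finset (Fin M × Bool)) :
    #{σ : Configuration M n d | endsIn σ A = S} * (2 * M).choose (#A * d)
      ≤ (2 * M).factorial := by
  by_cases hS : #S = #A * d
  swap
  · have : ({σ : Configuration M n d | endsIn σ A = S} : Finset _) = ∅ := by
      rw [filter_eq_empty_iff]
      rintro σ _ rfl
      exact hS (card_endsIn σ A)
    rw [this]
    simp
  have hsame : ∀ S' ∈ powersetCard (#A * d) (univ : Finset (Fin M × Bool)),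
      #{σ : Configuration M n d | endsIn σ A = S'} = #{σ : Configuration M n d | endsIn σ A = S} := by
    intro S' hS'
    rw [mem_powersetCard] at hS'
    have := Set.powersetCard.isPretransitive (α := Fin M × Bool) (n := #A * d)
    obtain ⟨τ, hτ⟩ := MulAction.exists_smul_eq (Equiv.Perm (Fin M × Bool))
      (⟨S, hS⟩ : Set.powersetCard (Fin M × Bool) (#A * d)) ⟨S', hS'.2⟩
    have hτ' : ∀ x, τ x ∈ S' ↔ x ∈ S := by
      intro x
      have h : τ • S = S' := congrArg Subtype.val hτ
      rw [← h]
      exact Finset.smul_mem_smul_finset_iff τ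
    refine Finset.card_bij' (fun σ _ => τ.trans σ) (fun σ _ => τ.symm.trans σ) ?_ ?_ ?_ ?_
    · intro σ hσ
      simp only [mem_filter, mem_univ, true_and] at hσ ⊢
      ext x
      rw [← hτ' x, ← hσ, mem_endsIn, mem_endsIn]
      rfl
    · intro σ hσ
      simp only [mem_filter, mem_univ, true_and] at hσ ⊢
      ext x
      rw [mem_endsIn, Equiv.trans_apply, ← mem_endsIn, hσ, ← hτ']
      simp
    · intro σ _
      ext1 q
      simp
    · intro σ _
      ext1 q
      simp
  have h := card_eq_sum_card_fiberwise (s := (univ : Finset (Configuration M n d)))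
    (t := powersetCard (#A * d) (univ : Finset (Fin M × Bool))) (f := fun σ => endsIn σ A) (by
      intro σ _
      simp [card_endsIn])
  rw [sum_congr rfl hsame, sum_const, card_powersetCard, card_univ, card_configuration hM,
    card_univ, smul_eq_mul] at h
  rw [h]
  simp [mul_comm]

theorem card_eq_sum_ends (S : Finset (Fin M × Bool)) :
    #S = ∑ e : Fin M, ((if (e, false) ∈ S then 1 else 0) + (if (e, true) ∈ S then 1 else 0)) := by
  have : #S = ∑ x : Fin M × Bool, if x ∈ S then 1 else 0 := by simp
  rw [this, Fintype.sum_prod_type]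
  refine sum_congr rfl fun e _ => ?_
  rw [Fintype.sum_bool, add_comm]

/-- The numbers of edges with two, one and no ends in a set of edge ends. -/
theorem card_full_add {S : Finset (Fin M × Bool)} {m h r : ℕ}
    (hm : #{e | (e, false) ∈ S ∧ (e, true) ∈ S} = m) (hh : 2 * m + h = #S)
    (hr : m + h + r = M) :
    #{e | ¬((e, false) ∈ S ↔ (e, true) ∈ S)} = h ∧ #{e | (e, false) ∉ S ∧ (e, true) ∉ S} = r := by
  have h1 := card_eq_sum_ends S
  have h2 : #S = 2 * #{e | (e, false) ∈ S ∧ (e, true) ∈ S} +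
      #{e | ¬((e, false) ∈ S ↔ (e, true) ∈ S)} := by
    rw [h1, card_filter, card_filter, mul_sum, ← sum_add_distrib]
    refine sum_congr rfl fun e _ => ?_
    by_cases ha : (e, false) ∈ S <;> by_cases hb : (e, true) ∈ S <;> simp [ha, hb]
  have h3 : M = #{e | (e, false) ∈ S ∧ (e, true) ∈ S} +
      #{e | ¬((e, false) ∈ S ↔ (e, true) ∈ S)} + #{e | (e, false) ∉ S ∧ (e, true) ∉ S} := by
    have : M = ∑ _e : Fin M, 1 := by simp
    conv_lhs => rw [this]
    rw [card_filter, card_filter, card_filter, ← sum_add_distrib, ← sum_add_distrib]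
    refine sum_congr rfl fun e _ => ?_
    by_cases ha : (e, false) ∈ S <;> by_cases hb : (e, true) ∈ S <;> simp [ha, hb]
  omega

theorem card_full_eq_mul_le {m h r : ℕ} (hr : m + h + r = M) :
    #{S : Finset (Fin M × Bool) | #S = 2 * m + h ∧ #{e | (e, false) ∈ S ∧ (e, true) ∈ S} = m}
      * ((2 * m) ^ m * h ^ h * (2 * r) ^ r) ≤ (2 * M) ^ M := by
  -- Weight 2m for an edge with both ends in S, h for each of the two ways to have one, and 2r for
  -- none; the total is 2M. In the expansion of (2M)^M every admissible S contributes exactly the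
  -- bracketed product, which gives the entropy bound.
  let w : Bool × Bool → ℕ := fun b =>
    (2 * m) ^ (if b.1 = true ∧ b.2 = true then 1 else 0) * h ^ (if ¬(b.1 = true ↔ b.2 = true) then 1 else 0)
      * (2 * r) ^ (if b.1 ≠ true ∧ b.2 ≠ true then 1 else 0)
  have hw : ∑ b, w b = 2 * M := by
    rw [Fintype.sum_prod_type]
    simp [w]
    omega
  let g : Finset (Fin M × Bool) → Fin M → Bool × Bool :=
    fun S e => (decide ((e, false) ∈ S), decide ((e, true) ∈ S))
  have hg : Function.Injective g := by
    intro S T hST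
    ext ⟨e, b⟩
    have := congrFun hST e
    simp only [g, Prod.mk.injEq, decide_eq_decide] at this
    cases b
    · exact this.1
    · exact this.2
  rw [← hw]
  have hpow : (∑ b, w b) ^ M = ∑ p : Fin M → Bool × Bool, ∏ e, w (p e) := by
    rw [Fintype.sum_pow]
  rw [hpow, ← smul_eq_mul, ← sum_const]
  refine le_trans (le_of_eq ?_) (sum_le_sum_of_subset (subset_univ
    (image g {S : Finset (Fin M × Bool) |
      #S = 2 * m + h ∧ #{e | (e, false) ∈ S ∧ (e, true) ∈ S} = m})))
  rw [sum_image hg.injOn]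
  refine sum_congr rfl fun S hS => ?_
  simp only [mem_filter, mem_univ, true_and] at hS
  have hc := card_full_add hS.2 hS.1.symm hr
  simp only [w, g, decide_eq_true_eq, prod_mul_distrib, prod_pow_eq_pow_sum, ne_eq, ← card_filter]
  rw [hS.2, hc.1, hc.2]

theorem exists_inner_add (σ : Configuration M n d) (A : Finset (Fin n)) :
    ∃ h r, 2 * inner σ A + h = #A * d ∧ inner σ A + h + r = M := by
  have hi : inner σ A = #{e | (e, false) ∈ endsIn σ A ∧ (e, true) ∈ endsIn σ A} := by
    simp only [inner, mem_endsIn]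
  have h1 := card_eq_sum_ends (endsIn σ A)
  have h2 : 2 * inner σ A ≤ #(endsIn σ A) := by
    rw [h1, hi, card_filter, mul_sum]
    refine sum_le_sum fun e _ => ?_
    by_cases ha : (e, false) ∈ endsIn σ A <;> by_cases hb : (e, true) ∈ endsIn σ A <;> simp [ha, hb]
  have h3 : #(endsIn σ A) ≤ inner σ A + ∑ _e : Fin M, 1 := by
    rw [h1, hi, card_filter, ← sum_add_distrib]
    refine sum_le_sum fun e _ => ?_
    by_cases ha : (e, false) ∈ endsIn σ A <;> by_cases hb : (e, true) ∈ endsIn σ A <;> simp [ha, hb]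
  rw [card_endsIn] at h2 h3
  simp only [sum_const, card_univ, Fintype.card_fin, smul_eq_mul, mul_one] at h3
  exact ⟨#A * d - 2 * inner σ A, M - inner σ A - (#A * d - 2 * inner σ A), by omega, by omega⟩

theorem card_inner_eq_mul_le (hM : 2 * M = n * d) (A : Finset (Fin n)) {m h r : ℕ}
    (hh : 2 * m + h = #A * d) (hr : m + h + r = M) :
    #{σ : Configuration M n d | inner σ A = m} *
        ((2 * M).choose (#A * d) * ((2 * m) ^ m * h ^ h * (2 * r) ^ r))
      ≤ (2 * M).factorial * (2 * M) ^ M := by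
  let I : Finset (Finset (Fin M × Bool)) :=
    {S | #S = 2 * m + h ∧ #{e | (e, false) ∈ S ∧ (e, true) ∈ S} = m}
  have h1 : #{σ : Configuration M n d | inner σ A = m} ≤
      ∑ S ∈ I, #{σ : Configuration M n d | endsIn σ A = S} := by
    rw [card_eq_sum_card_fiberwise (f := fun σ => endsIn σ A) (t := I)]
    · refine sum_le_sum fun S _ => card_le_card ?_
      exact filter_subset_filter _ (subset_univ _)
    · intro σ hσ
      simp only [coe_filter, mem_univ, true_and, Set.mem_ofPred_eq, I] at hσ ⊢
      refine ⟨by rw [card_endsIn, hh], ?_⟩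
      rw [← hσ]
      simp only [inner, mem_endsIn]
  have h2 : (∑ S ∈ I, #{σ : Configuration M n d | endsIn σ A = S}) * (2 * M).choose (#A * d)
      ≤ #I * (2 * M).factorial := by
    rw [sum_mul, ← smul_eq_mul (#I), ← sum_const]
    exact sum_le_sum fun S _ => card_endsIn_eq_mul_choose_le hM A S
  have h3 : #I * ((2 * m) ^ m * h ^ h * (2 * r) ^ r) ≤ (2 * M) ^ M := card_full_eq_mul_le hr
  calc _ = #{σ : Configuration M n d | inner σ A = m} * (2 * M).choose (#A * d) *
        ((2 * m) ^ m * h ^ h * (2 * r) ^ r) := by ring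
    _ ≤ #I * (2 * M).factorial * ((2 * m) ^ m * h ^ h * (2 * r) ^ r) :=
        Nat.mul_le_mul_right _ ((Nat.mul_le_mul_right _ h1).trans h2)
    _ = (2 * M).factorial * (#I * ((2 * m) ^ m * h ^ h * (2 * r) ^ r)) := by ring
    _ ≤ _ := Nat.mul_le_mul_left _ h3

/-- A union bound over the sets of size k. The number of sets is bounded above by one binomial term,
and the number of possible end sets below by the modal term, at the cost of the factor nd + 1. -/
theorem card_exists_inner_eq_mul_le (hM : 2 * M = n * d) {k l m h r : ℕ} (hkl : k + l = n)
    (hh : 2 * m + h = k * d) (hr : m + h + r = M) :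
    #{σ : Configuration M n d | ∃ A, #A = k ∧ inner σ A = m} *
        (k ^ k * l ^ l * ((2 * m) ^ m * h ^ h * (2 * r) ^ r) * (n * d) ^ (n * d))
      ≤ (2 * M).factorial * (n * d + 1) *
        (n ^ n * (n * d) ^ M * ((k * d) ^ (k * d) * (l * d) ^ (l * d))) := by
  set W := (2 * m) ^ m * h ^ h * (2 * r) ^ r
  set F := (2 * M).factorial
  set B := #{σ : Configuration M n d | ∃ A, #A = k ∧ inner σ A = m} with hB
  have hnd : k * d + l * d = n * d := by rw [← hkl]; ring
  have h1 : B ≤ ∑ A ∈ powersetCard k (univ : Finset (Fin n)),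
      #{σ : Configuration M n d | inner σ A = m} := by
    refine le_trans (card_le_card ?_) card_biUnion_le
    intro σ hσ
    simp only [mem_filter, mem_univ, true_and, mem_biUnion, mem_powersetCard, subset_univ] at hσ ⊢
    exact hσ
  have h2 : B * ((2 * M).choose (k * d) * W) ≤ n.choose k * (F * (2 * M) ^ M) := by
    refine (Nat.mul_le_mul_right _ h1).trans ?_
    rw [sum_mul]
    refine (sum_le_card_nsmul _ _ (F * (2 * M) ^ M) fun A hA => ?_).trans ?_
    · rw [mem_powersetCard] at hA
      rw [← hA.2]
      exact card_inner_eq_mul_le hM A (by rw [hA.2, hh]) hr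
    · rw [card_powersetCard, smul_eq_mul, card_univ, Fintype.card_fin]
  have h3 := choose_mul_pow_le k l
  have h4 := pow_le_succ_mul_choose_mul_pow (k * d) (l * d)
  rw [hkl] at h3
  rw [hnd] at h4
  rw [hM] at h2
  set P := (k * d) ^ (k * d) * (l * d) ^ (l * d)
  calc B * (k ^ k * l ^ l * W * (n * d) ^ (n * d))
      ≤ B * (k ^ k * l ^ l * W * ((n * d + 1) * ((n * d).choose (k * d) * P))) := by gcongr
    _ = B * ((n * d).choose (k * d) * W) * ((k ^ k * l ^ l) * (n * d + 1) * P) := by ring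
    _ ≤ n.choose k * (F * (n * d) ^ M) * ((k ^ k * l ^ l) * (n * d + 1) * P) :=
        Nat.mul_le_mul_right _ h2
    _ = n.choose k * (k ^ k * l ^ l) * (F * (n * d) ^ M * (n * d + 1) * P) := by ring
    _ ≤ n ^ n * (F * (n * d) ^ M * (n * d + 1) * P) := Nat.mul_le_mul_right _ h3
    _ = _ := by ring

end Configuration

theorem mul_log_div (t : ℝ) {s : ℝ} (hs : s ≠ 0) :
    t * Real.log (t / s) = t * Real.log t - t * Real.log s := by
  rcases eq_or_ne t 0 with rfl | ht
  · simp
  · rw [Real.log_div ht hs]; ring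

/-- This identifies nf as the logarithm of the ratio of powers in the counting bound. Zero values of
m, h and r are allowed because 0 log 0 = 0. -/
theorem mul_entropyF_eq {n d k l m h r : ℝ} (hk : 0 < k) (hl : 0 < l) (hd : 0 < d)
    (hkl : k + l = n) (hh : 2 * m + h = k * d) (hr : 2 * (m + h + r) = n * d) :
    n * entropyF (k / n) (2 * m / k) d =
      n * Real.log n + n * d / 2 * Real.log (n * d) + k * d * Real.log (k * d)
        + l * d * Real.log (l * d) - k * Real.log k - l * Real.log l - m * Real.log (2 * m)
        - h * Real.log h - r * Real.log (2 * r) - n * d * Real.log (n * d) := by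
  have hn : 0 < n := by linarith
  have e1 : 1 - k / n = l / n := by field_simp; linarith
  have e2 : d - 2 * m / k = h / k := by field_simp; linarith
  have e3 : d - 2 * (k / n) * d + k / n * (2 * m / k) = 2 * r / n := by field_simp; linarith
  have l1 := mul_log_div (2 * m) hk.ne'
  have l2 := mul_log_div h hk.ne'
  have l3 := mul_log_div (2 * r) hn.ne'
  have expand : n * entropyF (k / n) (2 * m / k) d =
      (m - k) * Real.log (k / n) + l * (d - 1) * Real.log (l / n) + n * d * Real.log d / 2
      - 2 * m * Real.log (2 * m / k) / 2 - h * Real.log (h / k)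
      - 2 * r * Real.log (2 * r / n) / 2 := by
    unfold entropyF
    rw [e1, e2, e3]
    field_simp
  rw [expand, l1, l2, l3, Real.log_div hk.ne' hn.ne', Real.log_div hl.ne' hn.ne',
    Real.log_mul hn.ne' hd.ne', Real.log_mul hk.ne' hd.ne', Real.log_mul hl.ne' hd.ne']
  have hl' : l = n - k := by linarith
  have hh' : h = k * d - 2 * m := by linarith
  have hr' : r = n * d / 2 - k * d + m := by linarith
  generalize Real.log n = L1
  generalize Real.log d = L2
  generalize Real.log k = L3
  generalize Real.log l = L4
  generalize Real.log (2 * m) = L5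
  generalize Real.log h = L6
  generalize Real.log (2 * r) = L7
  subst hl' hh' hr'
  ring

theorem natCast_pow_eq_exp (a : ℕ) (b : ℕ) (hab : a = 0 → b = 0) :
    ((a : ℝ) ^ b) = Real.exp (b * Real.log a) := by
  rcases Nat.eq_zero_or_pos a with h | h
  · simp [hab h]
  · rw [← Real.log_pow, Real.exp_log (by positivity)]

namespace Configuration

variable {M n d : ℕ}

/-- The first-moment bound: the proportion of configurations in which some set of `k` vertices
spans exactly `m` edges. -/
theorem card_exists_inner_eq_le (hM : 2 * M = n * d) (hd : 0 < d) {k m : ℕ} (hk : 0 < k)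
    (hkn : k < n) :
    (#{σ : Configuration M n d | ∃ A, #A = k ∧ inner σ A = m} : ℝ)
      ≤ (2 * M).factorial * (n * d + 1) * Real.exp (n * entropyF (k / n) (2 * m / k) d) := by
  -- A witness guarantees that the numbers h and r of edges with one and no end in A exist as
  -- natural numbers; without one the bound is trivial.
  rcases Finset.eq_empty_or_nonempty
    ({σ : Configuration M n d | ∃ A, #A = k ∧ inner σ A = m} : Finset _) with he | ⟨σ, hσ⟩
  · rw [he]
    simp only [card_empty, Nat.cast_zero]
    positivity
  simp only [mem_filter, mem_univ, true_and] at hσ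
  obtain ⟨A, rfl, rfl⟩ := hσ
  obtain ⟨h, r, hh, hr⟩ := exists_inner_add σ A
  obtain ⟨l, hkl⟩ : ∃ l, #A + l = n := ⟨n - #A, by omega⟩
  set k := #A
  set m := inner σ A
  have hl : 0 < l := by omega
  have key := card_exists_inner_eq_mul_le hM hkl hh hr
  set B := #{σ : Configuration M n d | ∃ A, #A = k ∧ inner σ A = m}
  have keyR : (B : ℝ) * ((k : ℝ) ^ k * (l : ℝ) ^ l *
      (((2 * m : ℕ) : ℝ) ^ m * (h : ℝ) ^ h * ((2 * r : ℕ) : ℝ) ^ r) * ((n * d : ℕ) : ℝ) ^ (n * d))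
      ≤ (2 * M).factorial * (n * d + 1) * ((n : ℝ) ^ n * ((n * d : ℕ) : ℝ) ^ M *
        (((k * d : ℕ) : ℝ) ^ (k * d) * ((l * d : ℕ) : ℝ) ^ (l * d))) := by
    exact_mod_cast key
  have hent := mul_entropyF_eq (n := n) (d := d) (k := k) (l := l) (m := m) (h := h) (r := r)
    (by exact_mod_cast hk) (by exact_mod_cast hl) (by exact_mod_cast hd) (by exact_mod_cast hkl)
    (by exact_mod_cast hh) (by rw [← Nat.cast_add, ← Nat.cast_add, hr]; exact_mod_cast hM)
  have hMr : (n : ℝ) * d / 2 = M := by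
    have : (2 : ℝ) * M = n * d := by exact_mod_cast hM
    linarith
  rw [hMr] at hent
  have hnd : n * d ≠ 0 := Nat.mul_ne_zero (by omega) hd.ne'
  have hid : (n : ℝ) ^ n * ((n * d : ℕ) : ℝ) ^ M *
        (((k * d : ℕ) : ℝ) ^ (k * d) * ((l * d : ℕ) : ℝ) ^ (l * d))
      = Real.exp (n * entropyF (k / n) (2 * m / k) d) * ((k : ℝ) ^ k * (l : ℝ) ^ l *
      (((2 * m : ℕ) : ℝ) ^ m * (h : ℝ) ^ h * ((2 * r : ℕ) : ℝ) ^ r) *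
        ((n * d : ℕ) : ℝ) ^ (n * d)) := by
    rw [natCast_pow_eq_exp n n id, natCast_pow_eq_exp (n * d) M (fun h => absurd h hnd),
      natCast_pow_eq_exp (k * d) _ id, natCast_pow_eq_exp (l * d) _ id, natCast_pow_eq_exp k k id,
      natCast_pow_eq_exp l l id, natCast_pow_eq_exp (2 * m) m (by omega),
      natCast_pow_eq_exp h h id, natCast_pow_eq_exp (2 * r) r (by omega),
      natCast_pow_eq_exp (n * d) (n * d) id, hent]
    simp only [← Real.exp_add]
    congr 1
    push_cast
    ring
  rw [hid] at keyR
  refine le_of_mul_le_mul_right (keyR.trans_eq (mul_assoc _ _ _).symm) ?_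
  have p1 : ∀ a : ℕ, (0 : ℝ) < (a : ℝ) ^ a := fun a => by
    rcases Nat.eq_zero_or_pos a with h | h
    · simp [h]
    · positivity
  have p2 : ∀ a : ℕ, (0 : ℝ) < ((2 * a : ℕ) : ℝ) ^ a := fun a => by
    rcases Nat.eq_zero_or_pos a with h | h
    · simp [h]
    · positivity
  exact mul_pos (mul_pos (mul_pos (p1 k) (p1 l)) (mul_pos (mul_pos (p2 m) (p1 h)) (p2 r)))
    (p1 (n * d))

end Configuration

/-! ### From configurations to random regular graphs -/

theorem regularGraphProb_le_one (n d : ℕ) (Q : SimpleGraph (Fin n) → Prop) :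
    regularGraphProb n d Q ≤ 1 := by
  unfold regularGraphProb
  refine div_le_one_of_le₀ ?_ (Nat.cast_nonneg _)
  have h : {G | G ∈ regularGraphs n d ∧ Q G} ⊆ regularGraphs n d := fun G hG => hG.1
  exact_mod_cast Set.ncard_le_ncard h (Set.toFinite _)

namespace Configuration

variable {M n d : ℕ}

theorem exists_card_exists_over (hM : 2 * M = n * d) :
    ∃ κ : ℕ, ∀ P ⊆ regularGraphs n d,
      {σ : Configuration M n d | ∃ G ∈ P, Over σ G}.ncard = P.ncard * κ := by
  classical
  obtain ⟨κ, hκ⟩ := exists_card_over (M := M) hM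
  refine ⟨κ, fun P hP => ?_⟩
  have h1 : {σ : Configuration M n d | ∃ G ∈ P, Over σ G}
      = ↑(P.toFinset.biUnion fun G => ({σ | Over σ G} : Finset (Configuration M n d))) := by
    ext σ
    simp
  rw [h1, Set.ncard_coe_finset, card_biUnion, Set.ncard_eq_toFinset_card', ← smul_eq_mul,
    ← sum_const]
  · refine sum_congr rfl fun G hG => ?_
    rw [← hκ G (hP (by simpa using hG)), ← Set.ncard_coe_finset]
    congr 1
    ext σ
    simp
  · intro G _ G' _ hne
    refine Finset.disjoint_left.2 fun σ hσ hσ' => hne ?_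
    simp only [mem_filter, mem_univ, true_and] at hσ hσ'
    exact hσ.unique hσ'

/-- Graph counts and counts of simple configurations differ by the common factor κ, so the
proportion of graphs failing Q is at most that of `B` relative to the simple configurations. -/
theorem one_sub_le_regularGraphProb (hM : 2 * M = n * d) {Q : SimpleGraph (Fin n) → Prop}
    {B : Finset (Configuration M n d)} (hpos : 0 < #{σ : Configuration M n d | #(bad σ) ≤ 0})
    (hB : ∀ σ G, G ∈ regularGraphs n d → Over σ G → ¬ Q G → σ ∈ B) :
    1 - (#B : ℝ) / #{σ : Configuration M n d | #(bad σ) ≤ 0} ≤ regularGraphProb n d Q := by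
  obtain ⟨κ, hκ⟩ := exists_card_exists_over (M := M) hM
  have hall := hκ (regularGraphs n d) le_rfl
  have hsimple : {σ : Configuration M n d | ∃ G ∈ regularGraphs n d, Over σ G}.ncard
      = #{σ : Configuration M n d | #(bad σ) ≤ 0} := by
    rw [← Set.ncard_coe_finset]
    congr 1
    ext σ
    simp only [Set.mem_ofPred_eq, coe_filter, mem_univ, true_and, ← injective_ends_iff]
    constructor
    · rintro ⟨G, hG, h⟩
      exact h.injective_ends hG
    · exact exists_over_of_injective
  rw [hsimple] at hall
  have hnot := hκ {G | G ∈ regularGraphs n d ∧ ¬ Q G} (fun G hG => hG.1)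
  have hle : {σ : Configuration M n d | ∃ G ∈ {G | G ∈ regularGraphs n d ∧ ¬ Q G}, Over σ G}.ncard
      ≤ #B := by
    rw [← Set.ncard_coe_finset]
    refine Set.ncard_le_ncard ?_ (Set.toFinite _)
    rintro σ ⟨G, hG, h⟩
    exact hB σ G hG.1 h hG.2
  rw [hnot] at hle
  have hsplit : {G | G ∈ regularGraphs n d ∧ Q G}.ncard +
      {G | G ∈ regularGraphs n d ∧ ¬ Q G}.ncard = (regularGraphs n d).ncard := by
    rw [← Set.ncard_union_eq (Set.disjoint_left.2 fun G h h' => h'.2 h.2) (Set.toFinite _)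
      (Set.toFinite _)]
    congr 1
    ext G
    simp only [Set.mem_union, Set.mem_ofPred_eq]
    tauto
  unfold regularGraphProb
  set S := #{σ : Configuration M n d | #(bad σ) ≤ 0}
  set R := (regularGraphs n d).ncard
  have hR : 0 < R := Nat.pos_of_ne_zero fun h => by simp [hall, h] at hpos
  have hκ0 : 0 < κ := Nat.pos_of_ne_zero fun h => by simp [hall, h] at hpos
  have hR' : (0 : ℝ) < R := by exact_mod_cast hR
  have hκ' : (0 : ℝ) < κ := by exact_mod_cast hκ0
  have hS : (S : ℝ) = R * κ := by exact_mod_cast hall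
  have hle' : ({G | G ∈ regularGraphs n d ∧ ¬ Q G}.ncard : ℝ) * κ ≤ #B := by exact_mod_cast hle
  have hsplit' : ({G | G ∈ regularGraphs n d ∧ Q G}.ncard : ℝ) +
      {G | G ∈ regularGraphs n d ∧ ¬ Q G}.ncard = R := by exact_mod_cast hsplit
  rw [hS, sub_le_iff_le_add, div_add_div _ _ hR'.ne' (by positivity), le_div_iff₀ (by positivity)]
  nlinarith

/-- Some vertex set of linear size spans too many edges. -/
theorem card_exists_dense_le (hM : 2 * M = n * d) (hn : 0 < n) (hd : 0 < d) {η δ c U : ℝ}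
    (hη : 0 < η)
    (hc : ∀ x y, η ≤ x → x ≤ 1 - η → d * (U + x) + δ ≤ y → y ≤ d → entropyF x y d ≤ -c)
    {B : Finset (Configuration M n d)}
    (hB : ∀ σ ∈ B, ∃ A : Finset (Fin n), η * n ≤ #A ∧ #A ≤ (1 - η) * n ∧
      (d * (U + #A / n) + δ) * #A < 2 * inner σ A) :
    (#B : ℝ) ≤ (n + 1) * (n * d + 1) *
      ((2 * M).factorial * (n * d + 1) * Real.exp (-c * n)) := by
  classical
  have hn' : (0 : ℝ) < n := by exact_mod_cast hn
  let T : Finset (ℕ × ℕ) := (range (n + 1) ×ˢ range (n * d + 1)).filter fun p =>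
    η * n ≤ p.1 ∧ p.1 ≤ (1 - η) * n ∧ (d * (U + p.1 / n) + δ) * p.1 < 2 * (p.2 : ℝ) ∧
      2 * p.2 ≤ p.1 * d
  let E : ℕ × ℕ → Finset (Configuration M n d) :=
    fun p => {σ | ∃ A, #A = p.1 ∧ inner σ A = p.2}
  have hsub : B ⊆ T.biUnion E := by
    intro σ hσ
    obtain ⟨A, h1, h2, h3⟩ := hB σ hσ
    obtain ⟨h, r, hh, hr⟩ := exists_inner_add σ A
    have hA : #A ≤ n := by simpa using card_le_univ A
    simp only [mem_biUnion, T, E, mem_filter, mem_product, mem_range, mem_univ, true_and]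
    exact ⟨(#A, inner σ A), ⟨⟨by omega, by omega⟩, h1, h2, h3, by simp only; omega⟩, A, rfl, rfl⟩
  have hterm : ∀ p ∈ T, (#(E p) : ℝ)
      ≤ (2 * M).factorial * (n * d + 1) * Real.exp (-c * n) := by
    rintro ⟨k, m⟩ hp
    simp only [T, mem_filter, mem_product, mem_range] at hp
    obtain ⟨_, h1, h2, h3, h4⟩ := hp
    have hk' : (0 : ℝ) < k := lt_of_lt_of_le (by positivity) h1
    have hk : 0 < k := by exact_mod_cast hk'
    have hkn : k < n := by
      have : (k : ℝ) < n := by nlinarith [mul_pos hη hn']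
      exact_mod_cast this
    refine (card_exists_inner_eq_le hM hd hk hkn).trans ?_
    have hf : entropyF (k / n) (2 * m / k) d ≤ -c := by
      refine hc _ _ ((le_div_iff₀ hn').2 h1) ((div_le_iff₀ hn').2 h2) ?_ ?_
      · exact (le_div_iff₀ hk').2 h3.le
      · rw [div_le_iff₀ hk', mul_comm (d : ℝ)]
        exact_mod_cast h4
    have he : n * entropyF (k / n) (2 * m / k) d ≤ -c * n := by nlinarith
    exact mul_le_mul_of_nonneg_left (Real.exp_le_exp.2 he) (by positivity)
  calc (#B : ℝ) ≤ ∑ p ∈ T, (#(E p) : ℝ) := by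
        exact_mod_cast (card_le_card hsub).trans card_biUnion_le
    _ ≤ #T * ((2 * M).factorial * (n * d + 1) * Real.exp (-c * n)) := by
        rw [← nsmul_eq_mul]
        exact sum_le_card_nsmul _ _ _ hterm
    _ ≤ _ := by
        gcongr
        have : #T ≤ (n + 1) * (n * d + 1) :=
          (card_filter_le _ _).trans (by rw [card_product, card_range, card_range])
        exact_mod_cast this

end Configuration

/-- The exponent combines the loss from restricting to simple configurations with three linear
factors: two from the union over (k, m) and one from the first moment bound. -/
theorem one_sub_le_regularGraphProb_modularity_le {n d : ℕ} (hd : 3 ≤ d) (hnd : Even (n * d))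
    (hlarge : 2 * (2 * d + 8 * d ^ 2) + (2 * d + 3) * d + 6 ≤ n) {η δ c U : ℝ} (hη : 0 < η)
    (hη3 : η ≤ 1 / 3) (hδ : 0 ≤ δ) (hU : 0 ≤ U)
    (hc : ∀ x y, η ≤ x → x ≤ 1 - η → d * (U + x) + δ ≤ y → y ≤ d → entropyF x y d ≤ -c) :
    1 - 2 * (2 * n * d) ^ (4 * (2 * d + 8 * d ^ 2) + 3) * Real.exp (-c * n) ≤
      regularGraphProb n d fun G => modularity G ≤ U + δ / d + 3 * η := by
  classical
  obtain ⟨M, hM'⟩ := hnd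
  have hM : 2 * M = n * d := by omega
  have hn : 0 < n := by omega
  have hnM : n ≤ 2 * M := by rw [hM]; exact Nat.le_mul_of_pos_right n (by omega)
  let B : Finset (Configuration M n d) := {σ | ∃ A : Finset (Fin n), η * n ≤ #A ∧
    #A ≤ (1 - η) * n ∧ (d * (U + #A / n) + δ) * #A < 2 * Configuration.inner σ A}
  have hsimple := Configuration.factorial_le_mul_card_simple (n := n) (d := d) hM (by omega)
    (by omega)
  have hpos : 0 < #{σ : Configuration M n d | #(Configuration.bad σ) ≤ 0} :=
    Nat.pos_of_ne_zero fun h => by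
      rw [h, mul_zero] at hsimple
      exact (Nat.factorial_pos _).ne' (Nat.le_zero.1 hsimple)
  refine le_trans ?_ (Configuration.one_sub_le_regularGraphProb hM hpos (B := B) ?_)
  · have hB := Configuration.card_exists_dense_le hM hn (by omega) hη hc (B := B)
      (fun σ hσ => by simpa [B] using hσ)
    set S := #{σ : Configuration M n d | #(Configuration.bad σ) ≤ 0}
    set a := 4 * (2 * d + 8 * d ^ 2)
    have hS : (0 : ℝ) < S := by exact_mod_cast hpos
    have hsR : ((2 * M).factorial : ℝ) ≤ 2 * (n * d) ^ a * S := by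
      rw [hM] at hsimple ⊢
      exact_mod_cast hsimple
    have hN : (1 : ℝ) ≤ n * d := by exact_mod_cast (by rw [← hM]; omega : 1 ≤ n * d)
    have hnN : (n : ℝ) ≤ n * d := by exact_mod_cast (by rw [← hM]; omega : n ≤ n * d)
    set N : ℝ := n * d with hNdef
    apply sub_le_sub_left
    rw [div_le_iff₀ hS]
    calc (#B : ℝ) ≤ (n + 1) * (N + 1) * ((2 * M).factorial * (N + 1) * Real.exp (-c * n)) := hB
      _ ≤ (2 * N) * (2 * N) * ((2 * (2 * N) ^ a * S) * (2 * N) * Real.exp (-c * n)) := by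
        have h3 : ((2 * M).factorial : ℝ) ≤ 2 * (2 * N) ^ a * S := by
          refine hsR.trans ?_
          gcongr
          linarith
        gcongr <;> linarith
      _ = 2 * (2 * n * d) ^ (a + 3) * Real.exp (-c * n) * S := by
        rw [mul_assoc 2 (n : ℝ), ← hNdef]
        ring
  · intro σ G hG hσ hmod
    by_contra hσB
    simp only [B, mem_filter, mem_univ, true_and, not_exists, not_and, not_lt] at hσB
    refine hmod (modularity_le_of_forall_linear hn (by omega) hG hη hη3 hU hδ fun A h1 h2 => ?_)
    rw [hσ.edgesInside_eq hG]
    exact hσB A h1 h2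

theorem tendsto_pow_mul_exp_neg_mul (a : ℕ) (b : ℝ) {c : ℝ} (hc : 0 < c) :
    Tendsto (fun n : ℕ => 2 * (2 * n * b) ^ a * Real.exp (-c * n)) atTop (𝓝 0) := by
  have h1 : Tendsto (fun n : ℕ => c * (n : ℝ)) atTop atTop :=
    tendsto_natCast_atTop_atTop.const_mul_atTop hc
  have h2 := ((Real.tendsto_pow_mul_exp_neg_atTop_nhds_zero a).comp h1).const_mul
    (2 * (2 * b / c) ^ a)
  rw [mul_zero] at h2
  refine h2.congr fun n => ?_
  have : (2 * n * b) ^ a = (2 * b / c) ^ a * (c * n) ^ a := by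
    rw [← mul_pow]
    congr 1
    field_simp
  simp only [Function.comp_apply]
  rw [this, neg_mul]
  ring

theorem mainTheorem2 (d : ℕ) (hd : 3 ≤ d) :
    -- `ȳ(x, d)` is the largest zero, and `U₃(d)` is the supremum
    (∀ x ∈ Set.Ioo (0 : ℝ) 1, IsGreatest (entropyZeros x d) (yBar x d)) ∧
    IsLUB ((fun x : ℝ => yBar x d / d - x) '' Set.Ioo 0 1) (boundU3 d) ∧
    -- the modularity bound
    ∀ ε : ℝ, 0 < ε →
      RegularAAS d (fun _ G => modularity G ≤ boundU3 d + ε / d) := by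
  have hd2 : (2 : ℝ) < d := by exact_mod_cast (by omega : 2 < d)
  refine ⟨fun x hx => (isGreatest_yBar hx hd2).1, isLUB_boundU3 hd2, fun ε hε => ?_⟩
  have hd0 : (0 : ℝ) < d := by linarith
  -- Half of ε/d pays for 3η, and the other half is δ/d with δ = ε/2.
  let η : ℝ := min (1 / 3) (ε / (6 * d))
  have hη : 0 < η := lt_min (by norm_num) (by positivity)
  obtain ⟨c, hc, hneg⟩ := exists_entropyF_le_neg hd2 (half_pos hε) hη
  have hbound : boundU3 d + ε / 2 / d + 3 * η ≤ boundU3 d + ε / d := by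
    have h1 : η ≤ ε / (6 * d) := min_le_right _ _
    have h2 : ε / d = ε / 2 / d + 3 * (ε / (6 * d)) := by field_simp; norm_num
    linarith
  unfold RegularAAS
  have hlim : Tendsto (fun n : ℕ => 1 - 2 * (2 * (n : ℝ) * d) ^ (4 * (2 * d + 8 * d ^ 2) + 3) *
      Real.exp (-c * n)) (atTop ⊓ 𝓟 {n : ℕ | Even (n * d)}) (𝓝 1) := by
    have := ((tendsto_pow_mul_exp_neg_mul (4 * (2 * d + 8 * d ^ 2) + 3) d hc).const_sub 1)
    rw [sub_zero] at this
    exact this.mono_left inf_le_left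
  refine tendsto_of_tendsto_of_tendsto_of_le_of_le' hlim tendsto_const_nhds ?_
    (Eventually.of_forall fun n => regularGraphProb_le_one n d _)
  rw [eventually_inf_principal]
  filter_upwards [eventually_ge_atTop (2 * (2 * d + 8 * d ^ 2) + (2 * d + 3) * d + 6)]
    with n hn hnd
  refine (one_sub_le_regularGraphProb_modularity_le hd hnd hn hη (min_le_left _ _)
    (half_pos hε).le (boundU3_pos hd2).le hneg).trans ?_
  unfold regularGraphProb
  gcongr
  exact Set.toFinite _
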